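/- **Setting.** Let $\hat{\mathbb C}=\mathbb C\cup\{\infty\}$ and $\Omega=\{(z,w)\in\hat{\mathbb C}^2 : z\cdot w\neq 1\}$, where $z\cdot\infty=\infty\cdot z=\infty$ for $z\ne 0$ and $0\cdot\infty=\infty\cdot 0=1$. $\Omega$ is a complex manifold with the two charts $(z,w)\mapsto(z,w)$ on $\Omega\cap\mathbb C^2$ and $(z,w)\mapsto(1/w,1/z)$ on $\Omega\cap(\hat{\mathbb C}\setminus\{0\})^2$. The spaces $\mathcal H(\mathbb C^2)$ and $\mathcal H(\Omega)$ of holomorphic functions carry the topology of locally uniform convergence. Let $\Omega_+=\{(z,w)\in\Omega : w\neq\infty\}$ and $\Omega_-=\{(z,w)\in\Omega : z\neq\infty\}$, with the bijections $$\Psi_+:\Omega_+\to\mathbb C^2,\ \Psi_+(z,w)=\Bigl(\frac{z}{1-zw},w\Bigr),\qquad \Psi_-:\Omega_-\to\mathbb C^2,\ \Psi_-(z,w)=\Bigl(z,\frac{w}{1-zw}\Bigr),$$ where $\frac{z}{1-zw}=-\frac1w$ for $z=\infty$ and $\frac{w}{1-zw}=-\frac1z$ for $w=\infty$. For $p,q\in\mathbb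 N_0$ let $f_{p,q}\in\mathcal H(\Omega)$ be the function $f_{p,q}(z,w)=\dfrac{z^pw^q}{(1-zw)^{\max\{p,q\}}}$, extended holomorphically to all of $\Omega$. Let $\mathcal H_+(\mathbb C^2)$ (the future) and $\mathcal H_-(\mathbb C^2)$ (the past) be the closed linear spans in $\mathcal H(\mathbb C^2)$ of the monomials $u^pv^q$ with $p\ge q$ and with $p<q$, respectively. Let $\mathcal H_+(\Omega)$ (the future) and $\mathcal H_-(\Omega)$ (the past) be the closed linear spans in $\mathcal H(\Omega)$ of the functions $f_{p,q}$ with $p\ge q$ and with $p<q$, respectively. For $F\in\mathcal H(\mathbb C^2)$ with Taylor coefficients $a_{p,q}=\frac{1}{p!\,q!}\partial_u^p\partial_v^qF(0,0)$ let $$\pi_+(F)=\sum_{p\ge q}a_{p,q}u^pv^q\in\mathcal H_+(\mathbb C^2),\qquad \pi_-(F)=\sum_{p<q}a_{p,q}u^pv^q\in\mathcal H_-(\mathbb C^2);$$ both series converge unconditionally in $\mathcal H(\mathbb C^2)$. **Theorem.** For each $F\in\mathcal H_\pm(\mathbb C^2)$ the function $F\circ\Psi_\pm$ on $\Omega_\pm$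 has exactly one extension $\Phi_\pm(F)\in\mathcal H(\Omega)$, this extension lies in $\mathcal H_\pm(\Omega)$, and $\Phi_\pm:\mathcal H_\pm(\mathbb C^2)\to\mathcal H_\pm(\Omega)$ is linear and continuous. The map $$\Phi:\mathcal H(\mathbb C^2)\to\mathcal H(\Omega),\qquad \Phi(F)=\Phi_+(\pi_+(F))+\Phi_-(\pi_-(F)),$$ is a continuous linear bijection, its inverse is continuous, and the inverse is given by $$\Phi^{-1}(f)=\pi_+\bigl(f\circ\Psi_+^{-1}\bigr)+\pi_-\bigl(f\circ\Psi_-^{-1}\bigr)\qquad(f\in\mathcal H(\Omega)),$$ where $f\circ\Psi_\pm^{-1}\in\mathcal H(\mathbb C^2)$. Moreover, $\Phi(\mathcal H_-(\mathbb C^2))=\mathcal H_-(\Omega)$ and $\Phi(\mathcal H_+(\mathbb C^2))=\mathcal H_+(\Omega)$. -/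

import Mathlib

noncomputable section

namespace HolOmega

open scoped OnePoint Topology

/-! ### The Riemann sphere and the manifold `Ω` -/

/-- The product on the Riemann sphere `OnePoint ℂ`, with the conventions
`z · ∞ = ∞ · z = ∞` for `z ≠ 0` and `0 · ∞ = ∞ · 0 = 1`. -/
def sphereMul : OnePoint ℂ → OnePoint ℂ → OnePoint ℂ
  | OnePoint.some z, OnePoint.some w => ((z * w : ℂ) : OnePoint ℂ)
  | OnePoint.some z, ∞ => if z = 0 then ((1 : ℂ) : OnePoint ℂ) else ∞
  | ∞, OnePoint.some w => if w = 0 then ((1 : ℂ) : OnePoint ℂ) else ∞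
  | ∞, ∞ => ∞

/-- The inversion `z ↦ 1 / z` of the Riemann sphere, with `1 / 0 = ∞` and `1 / ∞ = 0`. -/
def sphereInv : OnePoint ℂ → OnePoint ℂ
  | OnePoint.some z => if z = 0 then ∞ else ((z⁻¹ : ℂ) : OnePoint ℂ)
  | ∞ => ((0 : ℂ) : OnePoint ℂ)

/-- The complement of the complexified unit circle, `Ω = {(z, w) : z · w ≠ 1}`, with the subspace
topology of the product of two Riemann spheres. -/
abbrev Omega : Type := {x : OnePoint ℂ × OnePoint ℂ // sphereMul x.1 x.2 ≠ ((1 : ℂ) : OnePoint ℂ)}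

/-- The common image in `ℂ²` of the two charts of `Ω`. -/
def chartTarget : Set (ℂ × ℂ) := {y | y.1 * y.2 ≠ 1}

/-- The inverse of the standard chart `(z, w) ↦ (z, w)` of `Ω`. -/
def stdInv (y : chartTarget) : Omega :=
  ⟨(((y : ℂ × ℂ).1 : OnePoint ℂ), ((y : ℂ × ℂ).2 : OnePoint ℂ)), by
    intro h
    exact y.2 (OnePoint.coe_injective h)⟩

lemma sphereMul_flip {a b : ℂ} (h : a * b ≠ 1) :
    sphereMul (sphereInv b) (sphereInv a) ≠ ((1 : ℂ) : OnePoint ℂ) := by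
  by_cases ha : a = 0 <;> by_cases hb : b = 0
  · simp [sphereInv, sphereMul, ha, hb]
  · simp [sphereInv, sphereMul, ha, hb]
  · simp [sphereInv, sphereMul, ha, hb]
  · simp only [sphereInv, sphereMul, ha, hb, if_false]
    intro h'
    have h2 : b⁻¹ * a⁻¹ = 1 := OnePoint.coe_injective h'
    apply h
    field_simp at h2
    rw [mul_comm]; exact h2.symm

/-- The inverse `(a, b) ↦ (1 / b, 1 / a)` of the flip chart `(z, w) ↦ (1 / w, 1 / z)` of `Ω`. -/
def flipInv (y : chartTarget) : Omega :=
  ⟨(sphereInv (y : ℂ × ℂ).2, sphereInv (y : ℂ × ℂ).1), sphereMul_flip y.2⟩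

open Classical in
/-- A function on the chart image, extended by `0` to all of `ℂ²`. As the chart image is open, its
differentiability there does not depend on the extension. -/
def extendZero (g : chartTarget → ℂ) (y : ℂ × ℂ) : ℂ :=
  if h : y ∈ chartTarget then g ⟨y, h⟩ else 0

/-- A function on `Ω` is holomorphic if it is so in each of the two charts, which cover `Ω`. -/
def IsHolomorphic (f : Omega → ℂ) : Prop :=
  DifferentiableOn ℂ (extendZero (fun y => f (stdInv y))) chartTarget ∧
    DifferentiableOn ℂ (extendZero (fun y => f (flipInv y))) chartTarget

/-! ### The spaces of holomorphic functions, with the compact-open topology -/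

/-- `H(ℂ²)`: the entire functions on `ℂ²`, with the compact-open topology. -/
def HC2 : Submodule ℂ C(ℂ × ℂ, ℂ) where
  carrier := {F | Differentiable ℂ F}
  add_mem' hF hG := Differentiable.add hF hG
  zero_mem' := differentiable_const (0 : ℂ)
  smul_mem' c _ hF := Differentiable.const_smul hF c

lemma extendZero_add (g h : chartTarget → ℂ) :
    extendZero (fun y => g y + h y) = extendZero g + extendZero h := by
  funext y
  by_cases hy : y ∈ chartTarget <;> simp [extendZero, hy]

lemma extendZero_smul (c : ℂ) (g : chartTarget → ℂ) :
    extendZero (fun y => c * g y) = c • extendZero g := by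
  funext y
  by_cases hy : y ∈ chartTarget <;> simp [extendZero, hy]

/-- `H(Ω)`: the holomorphic functions on `Ω`, with the compact-open topology. -/
def HOmega : Submodule ℂ C(Omega, ℂ) where
  carrier := {f | IsHolomorphic f}
  add_mem' {f g} hf hg := by
    refine ⟨?_, ?_⟩
    · have := hf.1.add hg.1
      rwa [← extendZero_add] at this
    · have := hf.2.add hg.2
      rwa [← extendZero_add] at this
  zero_mem' := by
    have h0 : extendZero (fun _ => 0) = 0 := by
      funext y
      simp [extendZero]
    have : DifferentiableOn ℂ (extendZero (fun _ => 0)) chartTarget := by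
      rw [h0]; exact differentiableOn_const (0 : ℂ)
    exact ⟨this, this⟩
  smul_mem' c f hf := by
    refine ⟨?_, ?_⟩
    · have := hf.1.const_smul c
      rwa [← extendZero_smul] at this
    · have := hf.2.const_smul c
      rwa [← extendZero_smul] at this

instance : ContinuousAdd HC2 := HC2.topologicalAddGroup.toContinuousAdd

instance : ContinuousAdd HOmega := HOmega.topologicalAddGroup.toContinuousAdd

/-! ### Past and future of `H(ℂ²)` and the projections `π₊`, `π₋` -/

/-- The monomial `u ^ p * v ^ q`. -/
def monomial (p q : ℕ) : HC2 :=
  ⟨⟨fun y => y.1 ^ p * y.2 ^ q, by fun_prop⟩, by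
    change Differentiable ℂ (fun y : ℂ × ℂ => y.1 ^ p * y.2 ^ q)
    fun_prop⟩

lemma differentiableAt_div {g h : ℂ × ℂ → ℂ} {y : ℂ × ℂ} (hg : DifferentiableAt ℂ g y)
    (hh : DifferentiableAt ℂ h y) (h0 : h y ≠ 0) : DifferentiableAt ℂ (fun x => g x / h x) y := by
  simp only [div_eq_mul_inv]
  exact hg.mul (hh.inv h0)

/-- The future `H₊(ℂ²)`: the closed linear span of the monomials `u ^ p * v ^ q`, `p ≥ q`. -/
def HC2Plus : Submodule ℂ HC2 :=
  (Submodule.span ℂ {F : HC2 | ∃ p q : ℕ, q ≤ p ∧ F = monomial p q}).topologicalClosure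

/-- The past `H₋(ℂ²)`: the closed linear span of the monomials `u ^ p * v ^ q`, `p < q`. -/
def HC2Minus : Submodule ℂ HC2 :=
  (Submodule.span ℂ {F : HC2 | ∃ p q : ℕ, p < q ∧ F = monomial p q}).topologicalClosure

/-- The coefficient of `u ^ p * v ^ q` in the Taylor series of `F` at the origin,
`(∂ᵤ ^ p ∂ᵥ ^ q F) (0, 0) / (p! q!)`. -/
def taylorCoeff (F : HC2) (p q : ℕ) : ℂ :=
  iteratedDeriv p (fun u : ℂ => iteratedDeriv q (fun v : ℂ => F.1 (u, v)) 0) 0 /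
    ((p.factorial : ℂ) * (q.factorial : ℂ))

/-- The term `a_{p,q} u ^ p * v ^ q` of the Taylor series of `F` at the origin. -/
def taylorTerm (F : HC2) (n : ℕ × ℕ) : HC2 := taylorCoeff F n.1 n.2 • monomial n.1 n.2

/-- The projection `π₊ F = ∑_{p ≥ q} a_{p,q} u ^ p * v ^ q`, the sum being taken in `H(ℂ²)`. -/
def projPlus (F : HC2) : HC2Plus :=
  ⟨∑' n : {n : ℕ × ℕ // n.2 ≤ n.1}, taylorTerm F n, by
    refine tsum_mem (s := HC2Plus) isClosed_closure fun n => ?_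
    exact Submodule.smul_mem _ _ (Submodule.le_topologicalClosure _
      (Submodule.subset_span ⟨n.1.1, n.1.2, n.2, rfl⟩))⟩

/-- The projection `π₋ F = ∑_{p < q} a_{p,q} u ^ p * v ^ q`, the sum being taken in `H(ℂ²)`. -/
def projMinus (F : HC2) : HC2Minus :=
  ⟨∑' n : {n : ℕ × ℕ // n.1 < n.2}, taylorTerm F n, by
    refine tsum_mem (s := HC2Minus) isClosed_closure fun n => ?_
    exact Submodule.smul_mem _ _ (Submodule.le_topologicalClosure _
      (Submodule.subset_span ⟨n.1.1, n.1.2, n.2, rfl⟩))⟩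

/-! ### The functions `f_{p,q}` and the past and future of `H(Ω)` -/

/-- The affine coordinate on the sphere away from `∞`. -/
def coord : OnePoint ℂ → ℂ
  | OnePoint.some z => z
  | ∞ => 0

/-- The coordinate `1 / z` on the sphere away from `0`. -/
def recip : OnePoint ℂ → ℂ
  | OnePoint.some z => z⁻¹
  | ∞ => 0

@[simp] lemma coord_coe (z : ℂ) : coord (z : OnePoint ℂ) = z := rfl
@[simp] lemma recip_coe (z : ℂ) : recip (z : OnePoint ℂ) = z⁻¹ := rfl
@[simp] lemma recip_infty : recip ∞ = 0 := rfl

lemma continuousAt_coord {x : OnePoint ℂ} (hx : x ≠ ∞) : ContinuousAt coord x := by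
  obtain ⟨z, rfl⟩ := OnePoint.ne_infty_iff_exists.1 hx
  rw [OnePoint.continuousAt_coe]
  exact continuousAt_id

lemma continuousAt_recip {x : OnePoint ℂ} (hx : x ≠ ((0 : ℂ) : OnePoint ℂ)) :
    ContinuousAt recip x := by
  induction x using OnePoint.rec with
  | infty =>
    rw [OnePoint.continuousAt_infty', Filter.coclosedCompact_eq_cocompact,
      ← Metric.cobounded_eq_cocompact]
    exact Filter.tendsto_inv₀_cobounded
  | coe z =>
    rw [OnePoint.continuousAt_coe]
    have hz : z ≠ 0 := fun h => hx (by rw [h])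
    exact continuousAt_inv₀ hz

/-- The values of `f_{p,q}`. With `m = max p q` this is `z ^ p * w ^ q / (1 - z * w) ^ m` at finite
points; in terms of `a = 1 / w` and `b = 1 / z`, the same function is
`a ^ (m - q) * b ^ (m - p) / (a * b - 1) ^ m`, which gives its values at the points of `Ω` with an
infinite coordinate. -/
def fpqFun (p q : ℕ) : OnePoint ℂ → OnePoint ℂ → ℂ
  | OnePoint.some z, OnePoint.some w => z ^ p * w ^ q / (1 - z * w) ^ max p q
  | x, y => recip y ^ (max p q - q) * recip x ^ (max p q - p) /
      (recip y * recip x - 1) ^ max p q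

lemma fpqFun_finite (p q : ℕ) {x y : OnePoint ℂ} (hx : x ≠ ∞) (hy : y ≠ ∞) :
    fpqFun p q x y = coord x ^ p * coord y ^ q / (1 - coord x * coord y) ^ max p q := by
  obtain ⟨z, rfl⟩ := OnePoint.ne_infty_iff_exists.1 hx
  obtain ⟨w, rfl⟩ := OnePoint.ne_infty_iff_exists.1 hy
  rfl

lemma fpqFun_ne_zero (p q : ℕ) {x y : OnePoint ℂ} (hx : x ≠ ((0 : ℂ) : OnePoint ℂ))
    (hy : y ≠ ((0 : ℂ) : OnePoint ℂ)) :
    fpqFun p q x y = recip y ^ (max p q - q) * recip x ^ (max p q - p) /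
      (recip y * recip x - 1) ^ max p q := by
  induction x using OnePoint.rec with
  | infty => cases y <;> rfl
  | coe z =>
    induction y using OnePoint.rec with
    | infty => rfl
    | coe w =>
      have hz : z ≠ 0 := fun h => hx (by rw [h])
      have hw : w ≠ 0 := fun h => hy (by rw [h])
      change z ^ p * w ^ q / (1 - z * w) ^ max p q = w⁻¹ ^ (max p q - q) * z⁻¹ ^ (max p q - p) /
        (w⁻¹ * z⁻¹ - 1) ^ max p q
      obtain ⟨k, hk⟩ := Nat.exists_eq_add_of_le (le_max_left p q)
      obtain ⟨l, hl⟩ := Nat.exists_eq_add_of_le (le_max_right p q)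
      have e1 : max p q - p = k := by omega
      have e2 : max p q - q = l := by omega
      rw [e1, e2]
      have e3 : w⁻¹ * z⁻¹ - 1 = (1 - z * w) / (z * w) := by field_simp
      rw [e3, div_pow, div_div_eq_mul_div, inv_pow, inv_pow, mul_pow]
      congr 1
      have e4 : z ^ max p q = z ^ p * z ^ k := by rw [← pow_add, ← hk]
      have e5 : w ^ max p q = w ^ q * w ^ l := by rw [← pow_add, ← hl]
      rw [e4, e5]
      field_simp

lemma Omega.cases (x : Omega) :
    (x.1.1 ≠ ∞ ∧ x.1.2 ≠ ∞) ∨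
      (x.1.1 ≠ ((0 : ℂ) : OnePoint ℂ) ∧ x.1.2 ≠ ((0 : ℂ) : OnePoint ℂ)) := by
  obtain ⟨⟨x, y⟩, h⟩ := x
  induction x using OnePoint.rec with
  | infty =>
    right
    refine ⟨OnePoint.infty_ne_coe _, ?_⟩
    rintro rfl
    exact h (by simp [sphereMul])
  | coe z =>
    induction y using OnePoint.rec with
    | infty =>
      right
      refine ⟨?_, OnePoint.infty_ne_coe _⟩
      intro h0
      have hz : z = 0 := OnePoint.coe_injective h0
      exact h (by simp [sphereMul, hz])
    | coe w => exact Or.inl ⟨OnePoint.coe_ne_infty _, OnePoint.coe_ne_infty _⟩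

lemma one_sub_ne {x : Omega} (hx : x.1.1 ≠ ∞) (hy : x.1.2 ≠ ∞) :
    1 - coord x.1.1 * coord x.1.2 ≠ 0 := by
  obtain ⟨⟨x, y⟩, h⟩ := x
  obtain ⟨z, rfl⟩ := OnePoint.ne_infty_iff_exists.1 hx
  obtain ⟨w, rfl⟩ := OnePoint.ne_infty_iff_exists.1 hy
  intro h0
  have h1 : z * w = 1 := (sub_eq_zero.1 h0).symm
  apply h
  change ((z * w : ℂ) : OnePoint ℂ) = _
  rw [h1]

lemma recip_sub_one_ne {x : Omega} (hx : x.1.1 ≠ ((0 : ℂ) : OnePoint ℂ))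
    (hy : x.1.2 ≠ ((0 : ℂ) : OnePoint ℂ)) : recip x.1.2 * recip x.1.1 - 1 ≠ 0 := by
  obtain ⟨⟨x, y⟩, h⟩ := x
  induction x using OnePoint.rec with
  | infty => simp
  | coe z =>
    induction y using OnePoint.rec with
    | infty => simp
    | coe w =>
      have hz : z ≠ 0 := fun h => hx (congrArg OnePoint.some h)
      have hw : w ≠ 0 := fun h => hy (congrArg OnePoint.some h)
      intro h0
      apply h
      change ((z * w : ℂ) : OnePoint ℂ) = _
      have h1 : w⁻¹ * z⁻¹ = 1 := sub_eq_zero.1 h0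
      have h2 : z * w = 1 := by
        field_simp at h1
        rw [mul_comm]; exact h1.symm
      rw [h2]

lemma continuous_fpqFun (p q : ℕ) : Continuous (fun x : Omega => fpqFun p q x.1.1 x.1.2) := by
  rw [continuous_iff_continuousAt]
  intro x
  have c1 : ContinuousAt (fun x : Omega => x.1.1) x := by fun_prop
  have c2 : ContinuousAt (fun x : Omega => x.1.2) x := by fun_prop
  rcases Omega.cases x with ⟨h1, h2⟩ | ⟨h1, h2⟩
  · have d1 : ContinuousAt (fun x : Omega => coord x.1.1) x :=
      ContinuousAt.comp (f := fun x : Omega => x.1.1) (continuousAt_coord h1) c1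
    have d2 : ContinuousAt (fun x : Omega => coord x.1.2) x :=
      ContinuousAt.comp (f := fun x : Omega => x.1.2) (continuousAt_coord h2) c2
    have key : ContinuousAt (fun x : Omega => coord x.1.1 ^ p * coord x.1.2 ^ q /
        (1 - coord x.1.1 * coord x.1.2) ^ max p q) x :=
      ((d1.pow p).mul (d2.pow q)).div ((continuousAt_const.sub (d1.mul d2)).pow _)
        (pow_ne_zero _ (one_sub_ne h1 h2))
    refine key.congr ?_
    filter_upwards [c1.eventually_ne h1, c2.eventually_ne h2] with y e1 e2
    exact (fpqFun_finite p q e1 e2).symm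
  · have d1 : ContinuousAt (fun x : Omega => recip x.1.1) x :=
      ContinuousAt.comp (f := fun x : Omega => x.1.1) (continuousAt_recip h1) c1
    have d2 : ContinuousAt (fun x : Omega => recip x.1.2) x :=
      ContinuousAt.comp (f := fun x : Omega => x.1.2) (continuousAt_recip h2) c2
    have key : ContinuousAt (fun x : Omega => recip x.1.2 ^ (max p q - q) *
        recip x.1.1 ^ (max p q - p) / (recip x.1.2 * recip x.1.1 - 1) ^ max p q) x :=
      ((d2.pow _).mul (d1.pow _)).div (((d2.mul d1).sub continuousAt_const).pow _)
        (pow_ne_zero _ (recip_sub_one_ne h1 h2))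
    refine key.congr ?_
    filter_upwards [c1.eventually_ne h1, c2.eventually_ne h2] with y e1 e2
    exact (fpqFun_ne_zero p q e1 e2).symm

lemma sphereInv_ne_zero (a : ℂ) : sphereInv (a : OnePoint ℂ) ≠ ((0 : ℂ) : OnePoint ℂ) := by
  by_cases ha : a = 0
  · simp [sphereInv, ha]
  · simp only [sphereInv, ha, if_false]
    intro h
    exact inv_ne_zero ha (OnePoint.coe_injective h)

lemma recip_sphereInv (a : ℂ) : recip (sphereInv (a : OnePoint ℂ)) = a := by
  by_cases ha : a = 0 <;> simp [sphereInv, ha]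

lemma isHolomorphic_fpqFun (p q : ℕ) :
    IsHolomorphic (fun x : Omega => fpqFun p q x.1.1 x.1.2) := by
  refine ⟨?_, ?_⟩
  · have : DifferentiableOn ℂ (fun y : ℂ × ℂ => y.1 ^ p * y.2 ^ q / (1 - y.1 * y.2) ^ max p q)
        chartTarget := by
      intro y hy
      apply (differentiableAt_div _ _ _).differentiableWithinAt
      · fun_prop
      · fun_prop
      exact pow_ne_zero _ (sub_ne_zero.2 (Ne.symm hy))
    refine this.congr fun y hy => ?_
    simp only [extendZero, hy, dite_true]
    rfl
  · have : DifferentiableOn ℂ (fun y : ℂ × ℂ => y.1 ^ (max p q - q) * y.2 ^ (max p q - p) /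
        (y.1 * y.2 - 1) ^ max p q) chartTarget := by
      intro y hy
      apply (differentiableAt_div _ _ _).differentiableWithinAt
      · fun_prop
      · fun_prop
      exact pow_ne_zero _ (sub_ne_zero.2 hy)
    refine this.congr fun y hy => ?_
    simp only [extendZero, hy, dite_true, flipInv]
    rw [fpqFun_ne_zero p q (sphereInv_ne_zero _) (sphereInv_ne_zero _), recip_sphereInv,
      recip_sphereInv]

/-- The function `f_{p,q}(z, w) = z ^ p * w ^ q / (1 - z * w) ^ max p q` in `H(Ω)`. -/
def fpq (p q : ℕ) : HOmega :=
  ⟨⟨fun x => fpqFun p q x.1.1 x.1.2, continuous_fpqFun p q⟩, isHolomorphic_fpqFun p q⟩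

/-- The future `H₊(Ω)`: the closed linear span of the functions `f_{p,q}`, `p ≥ q`. -/
def HOmegaPlus : Submodule ℂ HOmega :=
  (Submodule.span ℂ {f : HOmega | ∃ p q : ℕ, q ≤ p ∧ f = fpq p q}).topologicalClosure

/-- The past `H₋(Ω)`: the closed linear span of the functions `f_{p,q}`, `p < q`. -/
def HOmegaMinus : Submodule ℂ HOmega :=
  (Submodule.span ℂ {f : HOmega | ∃ p q : ℕ, p < q ∧ f = fpq p q}).topologicalClosure

/-! ### The biholomorphic maps `Ψ₊ : Ω₊ → ℂ²` and `Ψ₋ : Ω₋ → ℂ²` -/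

/-- `Ω₊`: the points `(z, w)` of `Ω` with `w ≠ ∞`. -/
def OmegaPlus : Set Omega := {x | x.1.2 ≠ ∞}

/-- `Ω₋`: the points `(z, w)` of `Ω` with `z ≠ ∞`. -/
def OmegaMinus : Set Omega := {x | x.1.1 ≠ ∞}

/-- The first component `z / (1 - z * w)` of `Ψ₊`, which is `-1 / w` for `z = ∞`. -/
def quot : OnePoint ℂ → ℂ → ℂ
  | OnePoint.some z, w => z / (1 - z * w)
  | ∞, w => -1 / w

open Classical in
/-- The solution `z = u / (1 + u * v)` of `z / (1 - z * v) = u`, which is `∞` for `u * v = -1`. -/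
def quotInv (u v : ℂ) : OnePoint ℂ :=
  if 1 + u * v = 0 then ∞ else ((u / (1 + u * v) : ℂ) : OnePoint ℂ)

lemma sphereMul_comm (x y : OnePoint ℂ) : sphereMul x y = sphereMul y x := by
  induction x using OnePoint.rec <;> induction y using OnePoint.rec <;>
    simp [sphereMul, mul_comm]

lemma quotInv_mem (u v : ℂ) :
    sphereMul (quotInv u v) (v : OnePoint ℂ) ≠ ((1 : ℂ) : OnePoint ℂ) := by
  by_cases h : 1 + u * v = 0
  · have hv : v ≠ 0 := by rintro rfl; simp at h
    simp [quotInv, h, sphereMul, hv]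
  · simp only [quotInv, h, if_false, sphereMul]
    intro h'
    have h2 : u / (1 + u * v) * v = 1 := OnePoint.coe_injective h'
    rw [div_mul_eq_mul_div, div_eq_one_iff_eq h] at h2
    simp at h2

lemma quot_quotInv (u v : ℂ) : quot (quotInv u v) v = u := by
  by_cases h : 1 + u * v = 0
  · have hv : v ≠ 0 := by rintro rfl; simp at h
    simp only [quotInv, h, if_true, quot]
    rw [div_eq_iff hv]
    linear_combination -h
  · simp only [quotInv, h, if_false, quot]
    have : 1 - u / (1 + u * v) * v = 1 / (1 + u * v) := by
      field_simp
      ring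
    rw [this]
    field_simp

lemma quotInv_quot (x : OnePoint ℂ) (w : ℂ)
    (h : sphereMul x (w : OnePoint ℂ) ≠ ((1 : ℂ) : OnePoint ℂ)) : quotInv (quot x w) w = x := by
  induction x using OnePoint.rec with
  | infty =>
    have hw : w ≠ 0 := by rintro rfl; exact h (by simp [sphereMul])
    simp [quotInv, quot, hw]
  | coe z =>
    have hz : 1 - z * w ≠ 0 := by
      intro h0
      apply h
      change ((z * w : ℂ) : OnePoint ℂ) = _
      rw [(sub_eq_zero.1 h0).symm]
    have e : 1 + z / (1 - z * w) * w = 1 / (1 - z * w) := by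
      field_simp
      ring
    have hne : (1 : ℂ) / (1 - z * w) ≠ 0 := one_div_ne_zero hz
    simp only [quotInv, quot, e, hne, if_false]
    congr 1
    field_simp

lemma coe_coord {x : OnePoint ℂ} (hx : x ≠ ∞) : ((coord x : ℂ) : OnePoint ℂ) = x := by
  obtain ⟨z, rfl⟩ := OnePoint.ne_infty_iff_exists.1 hx
  rfl

/-- The bijection `Ψ₊ : Ω₊ → ℂ²`, `(z, w) ↦ (z / (1 - z * w), w)`. -/
def psiPlus : OmegaPlus ≃ ℂ × ℂ where
  toFun x := (quot x.1.1.1 (coord x.1.1.2), coord x.1.1.2)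
  invFun y := ⟨⟨(quotInv y.1 y.2, (y.2 : OnePoint ℂ)), quotInv_mem y.1 y.2⟩,
    OnePoint.coe_ne_infty _⟩
  left_inv := by
    rintro ⟨⟨⟨x, y⟩, h⟩, hy⟩
    obtain ⟨w, rfl⟩ := OnePoint.ne_infty_iff_exists.1 hy
    apply Subtype.ext
    apply Subtype.ext
    exact Prod.ext (quotInv_quot x w h) rfl
  right_inv := by
    rintro ⟨u, v⟩
    exact Prod.ext (quot_quotInv u v) rfl

/-- The bijection `Ψ₋ : Ω₋ → ℂ²`, `(z, w) ↦ (z, w / (1 - z * w))`. -/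
def psiMinus : OmegaMinus ≃ ℂ × ℂ where
  toFun x := (coord x.1.1.1, quot x.1.1.2 (coord x.1.1.1))
  invFun y := ⟨⟨((y.1 : OnePoint ℂ), quotInv y.2 y.1), by
    rw [sphereMul_comm]; exact quotInv_mem y.2 y.1⟩, OnePoint.coe_ne_infty _⟩
  left_inv := by
    rintro ⟨⟨⟨x, y⟩, h⟩, hx⟩
    obtain ⟨z, rfl⟩ := OnePoint.ne_infty_iff_exists.1 hx
    apply Subtype.ext
    apply Subtype.ext
    refine Prod.ext rfl (quotInv_quot y z ?_)
    rw [sphereMul_comm]; exact h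
  right_inv := by
    rintro ⟨u, v⟩
    exact Prod.ext rfl (quot_quotInv v u)

lemma isOpen_chartTarget : IsOpen chartTarget :=
  isOpen_ne_fun (by fun_prop) (by fun_prop)

lemma quotInv_eq_sphereInv {u v : ℂ} (hu : u ≠ 0) :
    quotInv u v = sphereInv (((1 + u * v) / u : ℂ) : OnePoint ℂ) := by
  by_cases h : 1 + u * v = 0
  · simp [quotInv, sphereInv, h]
  · have : (1 + u * v) / u ≠ 0 := div_ne_zero h hu
    simp only [quotInv, sphereInv, h, this, if_false]
    congr 1
    field_simp

lemma sphereInv_inv {v : ℂ} (hv : v ≠ 0) :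
    sphereInv ((v⁻¹ : ℂ) : OnePoint ℂ) = (v : OnePoint ℂ) := by
  simp [sphereInv, hv]

lemma differentiable_comp_psiPlus_symm {f : Omega → ℂ} (hf : IsHolomorphic f) :
    Differentiable ℂ (fun y : ℂ × ℂ => f (psiPlus.symm y).1) := by
  rintro ⟨u, v⟩
  by_cases h : 1 + u * v = 0
  · have hu : u ≠ 0 := by rintro rfl; simp at h
    have hv : v ≠ 0 := by rintro rfl; simp at h
    have hmem : ∀ y : ℂ × ℂ, y.1 ≠ 0 → y.2 ≠ 0 → (y.2⁻¹, (1 + y.1 * y.2) / y.1) ∈ chartTarget := by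
      intro y h1 h2 h3
      change y.2⁻¹ * ((1 + y.1 * y.2) / y.1) = 1 at h3
      field_simp at h3
      simp [mul_comm] at h3
    have d1 : DifferentiableAt ℂ (fun y : ℂ × ℂ => (y.2⁻¹, (1 + y.1 * y.2) / y.1)) (u, v) := by
      refine DifferentiableAt.prodMk (DifferentiableAt.inv (by fun_prop) hv) ?_
      apply differentiableAt_div
      · fun_prop
      · fun_prop
      exact hu
    have d2 := (hf.2.differentiableAt
      (isOpen_chartTarget.mem_nhds (hmem (u, v) hu hv))).comp (u, v) d1
    refine d2.congr_of_eventuallyEq ?_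
    have e1 : ∀ᶠ y : ℂ × ℂ in 𝓝 (u, v), y.1 ≠ 0 :=
      (continuous_fst.continuousAt (x := (u, v))).eventually_ne hu
    have e2 : ∀ᶠ y : ℂ × ℂ in 𝓝 (u, v), y.2 ≠ 0 :=
      (continuous_snd.continuousAt (x := (u, v))).eventually_ne hv
    filter_upwards [e1, e2] with y h1 h2
    simp only [Function.comp, extendZero, hmem y h1 h2, dite_true]
    congr 1
    apply Subtype.ext
    exact Prod.ext (quotInv_eq_sphereInv h1) (sphereInv_inv h2).symm
  · have hmem : ∀ y : ℂ × ℂ, 1 + y.1 * y.2 ≠ 0 → (y.1 / (1 + y.1 * y.2), y.2) ∈ chartTarget := by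
      intro y h1 h3
      change y.1 / (1 + y.1 * y.2) * y.2 = 1 at h3
      rw [div_mul_eq_mul_div, div_eq_one_iff_eq h1] at h3
      simp at h3
    have d1 : DifferentiableAt ℂ (fun y : ℂ × ℂ => (y.1 / (1 + y.1 * y.2), y.2)) (u, v) := by
      refine DifferentiableAt.prodMk ?_ (by fun_prop)
      apply differentiableAt_div
      · fun_prop
      · fun_prop
      exact h
    have d2 := (hf.1.differentiableAt
      (isOpen_chartTarget.mem_nhds (hmem (u, v) h))).comp (u, v) d1
    refine d2.congr_of_eventuallyEq ?_
    have c : Continuous (fun y : ℂ × ℂ => 1 + y.1 * y.2) := by fun_prop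
    filter_upwards [(c.continuousAt (x := (u, v))).eventually_ne h] with y h1
    simp only [Function.comp, extendZero, hmem y h1, dite_true]
    congr 1
    apply Subtype.ext
    refine Prod.ext ?_ rfl
    simp only [psiPlus, Equiv.coe_fn_symm_mk, quotInv, h1, if_false, stdInv]

lemma differentiable_comp_psiMinus_symm {f : Omega → ℂ} (hf : IsHolomorphic f) :
    Differentiable ℂ (fun y : ℂ × ℂ => f (psiMinus.symm y).1) := by
  rintro ⟨u, v⟩
  by_cases h : 1 + v * u = 0
  · have hu : u ≠ 0 := by rintro rfl; simp at h
    have hv : v ≠ 0 := by rintro rfl; simp at h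
    have hmem : ∀ y : ℂ × ℂ, y.1 ≠ 0 → y.2 ≠ 0 → ((1 + y.2 * y.1) / y.2, y.1⁻¹) ∈ chartTarget := by
      intro y h1 h2 h3
      change (1 + y.2 * y.1) / y.2 * y.1⁻¹ = 1 at h3
      field_simp at h3
      simp at h3
    have d1 : DifferentiableAt ℂ (fun y : ℂ × ℂ => ((1 + y.2 * y.1) / y.2, y.1⁻¹)) (u, v) := by
      refine DifferentiableAt.prodMk ?_ (DifferentiableAt.inv (by fun_prop) hu)
      apply differentiableAt_div
      · fun_prop
      · fun_prop
      exact hv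
    have d2 := (hf.2.differentiableAt
      (isOpen_chartTarget.mem_nhds (hmem (u, v) hu hv))).comp (u, v) d1
    refine d2.congr_of_eventuallyEq ?_
    have e1 : ∀ᶠ y : ℂ × ℂ in 𝓝 (u, v), y.1 ≠ 0 :=
      (continuous_fst.continuousAt (x := (u, v))).eventually_ne hu
    have e2 : ∀ᶠ y : ℂ × ℂ in 𝓝 (u, v), y.2 ≠ 0 :=
      (continuous_snd.continuousAt (x := (u, v))).eventually_ne hv
    filter_upwards [e1, e2] with y h1 h2
    simp only [Function.comp, extendZero, hmem y h1 h2, dite_true]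
    congr 1
    apply Subtype.ext
    exact Prod.ext (sphereInv_inv h1).symm (quotInv_eq_sphereInv h2)
  · have hmem : ∀ y : ℂ × ℂ, 1 + y.2 * y.1 ≠ 0 → (y.1, y.2 / (1 + y.2 * y.1)) ∈ chartTarget := by
      intro y h1 h3
      change y.1 * (y.2 / (1 + y.2 * y.1)) = 1 at h3
      rw [mul_div_assoc', div_eq_one_iff_eq h1] at h3
      simp [mul_comm] at h3
    have d1 : DifferentiableAt ℂ (fun y : ℂ × ℂ => (y.1, y.2 / (1 + y.2 * y.1))) (u, v) := by
      refine DifferentiableAt.prodMk (by fun_prop) ?_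
      apply differentiableAt_div
      · fun_prop
      · fun_prop
      exact h
    have d2 := (hf.1.differentiableAt
      (isOpen_chartTarget.mem_nhds (hmem (u, v) h))).comp (u, v) d1
    refine d2.congr_of_eventuallyEq ?_
    have c : Continuous (fun y : ℂ × ℂ => 1 + y.2 * y.1) := by fun_prop
    filter_upwards [(c.continuousAt (x := (u, v))).eventually_ne h] with y h1
    simp only [Function.comp, extendZero, hmem y h1, dite_true]
    congr 1
    apply Subtype.ext
    refine Prod.ext rfl ?_
    simp only [psiMinus, Equiv.coe_fn_symm_mk, quotInv, h1, if_false, stdInv]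

/-- The entire function `f ∘ Ψ₊⁻¹`, for `f ∈ H(Ω)`. -/
def compPsiPlusInv (f : HOmega) : HC2 :=
  ⟨⟨fun y => f.1 (psiPlus.symm y).1, (differentiable_comp_psiPlus_symm f.2).continuous⟩,
    differentiable_comp_psiPlus_symm f.2⟩

/-- The entire function `f ∘ Ψ₋⁻¹`, for `f ∈ H(Ω)`. -/
def compPsiMinusInv (f : HOmega) : HC2 :=
  ⟨⟨fun y => f.1 (psiMinus.symm y).1, (differentiable_comp_psiMinus_symm f.2).continuous⟩,
    differentiable_comp_psiMinus_symm f.2⟩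

/-- `f ∈ H(Ω)` is a holomorphic extension to `Ω` of the function `F ∘ Ψ₊` on `Ω₊`. -/
def ExtendsPlus (F : HC2) (f : HOmega) : Prop := ∀ x : OmegaPlus, f.1 x.1 = F.1 (psiPlus x)

/-- `f ∈ H(Ω)` is a holomorphic extension to `Ω` of the function `F ∘ Ψ₋` on `Ω₋`. -/
def ExtendsMinus (F : HC2) (f : HOmega) : Prop := ∀ x : OmegaMinus, f.1 x.1 = F.1 (psiMinus x)

end HolOmega

end

open HolOmega

noncomputable section

namespace HolOmega

open scoped OnePoint Topology
open Metric

/-! For `q ≤ p` one has `f_{p,q} = f_{1,0} ^ (p - q) * f_{1,1} ^ q`, and `f_{1,0}`, `f_{1,1}` become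
`u` and `u * v` under `Ψ₊⁻¹`. So `Φ₊ F` is obtained by replacing each `u ^ p * v ^ q` by `u ^ (p -
q) * v ^ q` and substituting `(f_{1,0}, f_{1,1})` into the resulting entire function, which is
holomorphic on all of `Ω`. `Φ₋` is symmetric. Cauchy estimates make the rearrangement of Taylor
coefficients continuous, since no index is assigned a coefficient of lower total degree. The
projections `π₊`, `π₋` are instances of the same operator, and the extensions are unique because the
finite points are dense in `Ω`.

The candidate inverse is a left inverse of `Φ` (`unglue_glue`): under `Ψ₋⁻¹` the function `f_{1,0}`
becomes `u * (1 + u * v)`, so `f_{p,q}` with `q ≤ p` becomes a sum of monomials with the same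
difference of exponents `p - q`. The wrong chart therefore never moves future to past or past to
future, and the cross terms die under the projections.

It remains to see that the candidate inverse is injective (`eq_zero_of_proj_eq_zero`). If it kills
`f`, then `f ∘ Ψ₊⁻¹` lies in the past and `f ∘ Ψ₋⁻¹` in the future. Along the orbit `l ↦ (l * z, w /
l)` the product `z * w` is constant, so `f` is there a series in `l` with only negative powers by
the first expansion and only nonnegative powers by the second. The removable singularity theorem and
Liouville's theorem give `f = 0`. An injective map with a right inverse is bijective, so no separate
proof of surjectivity of `Φ` is needed. -/

/-! ### Cauchy estimates for Taylor coefficients in two variables -/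

lemma differentiableAt_circleIntegral_param {F : ℂ × ℂ → ℂ} (hF : Differentiable ℂ F) {k : ℂ → ℂ}
    {R : ℝ} (hR : 0 < R) (hk : ContinuousOn k (sphere 0 R)) (u₀ : ℂ) :
    DifferentiableAt ℂ (fun u => ∮ ζ in C(0, R), k ζ • F (u, ζ)) u₀ := by
  have hkc : Continuous fun θ : ℝ => k (circleMap 0 R θ) :=
    hk.comp_continuous (continuous_circleMap 0 R) fun θ => circleMap_mem_sphere 0 hR.le θ
  have hdc : Continuous fun θ : ℝ => deriv (circleMap 0 R) θ := by
    simp only [deriv_circleMap]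
    fun_prop
  have hslice : ∀ ζ u, HasDerivAt (fun u => F (u, ζ)) (fderiv ℂ F (u, ζ) (1, 0)) u := by
    intro ζ u
    have h1 : HasDerivAt (fun u : ℂ => (u, ζ)) ((1 : ℂ), (0 : ℂ)) u :=
      (hasDerivAt_id u).prodMk (hasDerivAt_const u ζ)
    exact (hF (u, ζ)).hasFDerivAt.comp_hasDerivAt u h1
  -- Radius 2 leaves room for unit circles around the points of `ball u₀ 1`; Cauchy's estimate on
  -- these circles bounds the `u`-derivative by `M`.
  obtain ⟨M, hM⟩ := ((isCompact_closedBall u₀ 2).prod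
    (isCompact_sphere (0 : ℂ) R)).exists_bound_of_continuousOn hF.continuous.continuousOn
  obtain ⟨K, hK⟩ := (isCompact_sphere (0 : ℂ) R).exists_bound_of_continuousOn hk
  have hcont : ∀ u, Continuous fun θ : ℝ =>
      deriv (circleMap 0 R) θ • k (circleMap 0 R θ) • F (u, circleMap 0 R θ) := fun u =>
    hdc.smul (hkc.smul (hF.continuous.comp (by fun_prop)))
  have hmeas : Measurable fun θ : ℝ => fderiv ℂ F (u₀, circleMap 0 R θ) (1, 0) :=
    (measurable_fderiv_apply_const ℂ F (1, 0)).comp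
      (Continuous.measurable (by fun_prop : Continuous fun θ : ℝ => (u₀, circleMap 0 R θ)))
  have := (intervalIntegral.hasDerivAt_integral_of_dominated_loc_of_deriv_le
    (μ := MeasureTheory.volume) (a := 0) (b := 2 * Real.pi)
    (F := fun u θ => deriv (circleMap 0 R) θ • k (circleMap 0 R θ) • F (u, circleMap 0 R θ))
    (F' := fun u θ => deriv (circleMap 0 R) θ • k (circleMap 0 R θ) •
      fderiv ℂ F (u, circleMap 0 R θ) (1, 0)) (x₀ := u₀) (s := ball u₀ 1)
    (bound := fun _ => R * (K * M))
    (ball_mem_nhds _ one_pos) (Filter.Eventually.of_forall fun u => (hcont u).aestronglyMeasurable)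
    ((hcont u₀).intervalIntegrable _ _)
    ((hdc.measurable.smul (hkc.measurable.smul hmeas)).aestronglyMeasurable)
    ?_ intervalIntegrable_const ?_).2
  · exact this.differentiableAt
  · refine Filter.Eventually.of_forall fun θ _ u hu => ?_
    have hs := circleMap_mem_sphere (0 : ℂ) hR.le θ
    have h1 : ‖fderiv ℂ F (u, circleMap 0 R θ) (1, 0)‖ ≤ M := by
      rw [← (hslice (circleMap 0 R θ) u).deriv]
      have := Complex.norm_deriv_le_of_forall_mem_sphere_norm_le (C := M) (R := 1) (c := u) one_pos
        (f := fun u => F (u, circleMap 0 R θ))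
        (Differentiable.diffContOnCl fun u => (hslice _ u).differentiableAt) ?_
      · simpa using this
      · intro z hz
        refine hM _ ⟨?_, hs⟩
        rw [mem_closedBall]
        have : dist z u = 1 := hz
        have h2 : dist u u₀ < 1 := hu
        linarith [dist_triangle z u u₀]
    rw [norm_smul, norm_smul, deriv_circleMap]
    have h0 : ‖circleMap 0 R θ * Complex.I‖ = R := by simp [abs_of_pos hR]
    rw [h0]
    have hK0 := hK _ hs
    gcongr
    exact (norm_nonneg _).trans hK0
  · exact Filter.Eventually.of_forall fun θ _ u _ =>
      ((hslice (circleMap 0 R θ) u).fun_const_smul _).fun_const_smul _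

/-- Cauchy's formula turns the derivative in `v` into a circle integral that depends on `u` only as
a parameter. -/
lemma differentiable_iteratedDeriv_snd {F : ℂ × ℂ → ℂ} (hF : Differentiable ℂ F) (q : ℕ) :
    Differentiable ℂ fun u => iteratedDeriv q (fun v => F (u, v)) 0 := by
  have h : ∀ u, iteratedDeriv q (fun v => F (u, v)) 0 = (2 * Real.pi * Complex.I / q.factorial)⁻¹ •
      ∮ ζ in C(0, 1), (1 / (ζ - 0) ^ (q + 1)) • F (u, ζ) := by
    intro u
    have hd : Differentiable ℂ fun v => F (u, v) := hF.comp (by fun_prop)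
    rw [hd.diffContOnCl.circleIntegral_one_div_sub_center_pow_smul one_pos, inv_smul_smul₀]
    simp [Nat.factorial_ne_zero]
  simp only [h]
  intro u
  refine (differentiableAt_circleIntegral_param hF one_pos
    (k := fun ζ => 1 / (ζ - 0) ^ (q + 1)) ?_ u).fun_const_smul _
  refine ContinuousOn.div (by fun_prop) (by fun_prop) fun z hz => pow_ne_zero _ ?_
  rw [sub_zero]
  exact ne_of_mem_sphere hz one_ne_zero

/-- Two one-variable Cauchy estimates, first in `v`, then in `u`. The sup-norm ball is a bidisc, so
it contains the product of the two circles. -/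
lemma norm_taylorCoeff_le (F : HC2) {R M : ℝ} (hR : 0 < R)
    (hM : ∀ y ∈ closedBall (0 : ℂ × ℂ) R, ‖F.1 y‖ ≤ M) (p q : ℕ) :
    ‖taylorCoeff F p q‖ ≤ M / R ^ (p + q) := by
  have h1 : ∀ u ∈ sphere (0 : ℂ) R,
      ‖iteratedDeriv q (fun v => F.1 (u, v)) 0‖ ≤ q.factorial * M / R ^ q := by
    intro u hu
    have hd : Differentiable ℂ fun v => F.1 (u, v) := Differentiable.comp F.2 (by fun_prop)
    refine Complex.norm_iteratedDeriv_le_of_forall_mem_sphere_norm_le q hR hd.diffContOnCl ?_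
    intro v hv
    apply hM
    rw [mem_sphere_zero_iff_norm] at hu hv
    simp [Prod.norm_def, hu, hv]
  have h2 := Complex.norm_iteratedDeriv_le_of_forall_mem_sphere_norm_le p hR
    (differentiable_iteratedDeriv_snd F.2 q).diffContOnCl h1
  rw [taylorCoeff, norm_div, norm_mul, Complex.norm_natCast, Complex.norm_natCast,
    div_le_iff₀ (by positivity)]
  refine h2.trans_eq ?_
  rw [pow_add]
  field_simp

/-! ### Entire functions as sums of power series -/

lemma hasSum_half_pow : HasSum (fun n : ℕ × ℕ => (1 / 2 : ℝ) ^ (n.1 + n.2)) 4 := by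
  have h := hasSum_geometric_two
  have hs := h.summable.mul_of_nonneg h.summable (fun n => by positivity) (fun n => by positivity)
  have := h.mul h hs
  norm_num at this
  simpa [pow_add] using this

/-- Coefficients that decay fast enough for the power series to converge on all of `ℂ²`. -/
def EntireCoeff (c : ℕ × ℕ → ℂ) : Prop :=
  ∀ R : ℝ, 1 ≤ R → ∃ M : ℝ, ∀ n, ‖c n‖ ≤ M / R ^ (n.1 + n.2)

lemma norm_monomial_le {y : ℂ × ℂ} {r : ℝ} (hy : ‖y‖ ≤ r) (n : ℕ × ℕ) :
    ‖(monomial n.1 n.2).1 y‖ ≤ r ^ (n.1 + n.2) := by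
  change ‖y.1 ^ n.1 * y.2 ^ n.2‖ ≤ _
  rw [norm_mul, norm_pow, norm_pow, pow_add]
  have h1 := (norm_fst_le y).trans hy
  have h2 := (norm_snd_le y).trans hy
  gcongr
  exact pow_nonneg ((norm_nonneg _).trans h1) _

lemma norm_coeff_mul_monomial_le {c : ℕ × ℕ → ℂ} {r M : ℝ} (hr : 0 < r)
    (hc : ∀ n, ‖c n‖ ≤ M / (2 * r) ^ (n.1 + n.2)) {y : ℂ × ℂ} (hy : ‖y‖ ≤ r) (n : ℕ × ℕ) :
    ‖c n * (monomial n.1 n.2).1 y‖ ≤ M * (1 / 2) ^ (n.1 + n.2) := by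
  rw [norm_mul]
  refine (mul_le_mul (hc n) (norm_monomial_le hy n) (norm_nonneg _)
    ((norm_nonneg _).trans (hc n))).trans_eq ?_
  rw [mul_pow, one_div, inv_pow]
  field_simp

lemma EntireCoeff.differentiable {c : ℕ × ℕ → ℂ} (hc : EntireCoeff c) :
    Differentiable ℂ fun y => ∑' n, c n * (monomial n.1 n.2).1 y := by
  intro y₀
  set r : ℝ := ‖y₀‖ + 1 with hr
  have hr1 : 1 ≤ r := by linarith [norm_nonneg y₀]
  -- One factor 2 absorbs the degree `n.1 + n.2 ≤ 2 ^ (n.1 + n.2)` produced by differentiation, the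
  -- other leaves a convergent geometric series.
  obtain ⟨M, hM⟩ := hc (4 * r) (by linarith)
  have hM0 : 0 ≤ M := by simpa using (norm_nonneg _).trans (hM (0, 0))
  refine (hasFDerivAt_tsum_of_isPreconnected (𝕜 := ℂ) (s := ball (0 : ℂ × ℂ) r) (x₀ := 0)
    (u := fun n : ℕ × ℕ => M * (1 / 2) ^ (n.1 + n.2))
    (f := fun n y => c n * (monomial n.1 n.2).1 y)
    (f' := fun n y => c n • (y.1 ^ n.1 • ((n.2 * y.2 ^ (n.2 - 1)) • ContinuousLinearMap.snd ℂ ℂ ℂ)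
      + y.2 ^ n.2 • ((n.1 * y.1 ^ (n.1 - 1)) • ContinuousLinearMap.fst ℂ ℂ ℂ)))
    (hasSum_half_pow.summable.mul_left M) isOpen_ball (convex_ball _ _).isPreconnected
    ?_ ?_ (mem_ball_self (by linarith)) ?_ (x := y₀) (by simp [hr])).differentiableAt
  · intro n y _
    have h1 : HasFDerivAt (fun y : ℂ × ℂ => y.1 ^ n.1) _ y :=
      (hasDerivAt_pow n.1 y.1).comp_hasFDerivAt y (hasFDerivAt_fst (𝕜 := ℂ))
    have h2 : HasFDerivAt (fun y : ℂ × ℂ => y.2 ^ n.2) _ y :=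
      (hasDerivAt_pow n.2 y.2).comp_hasFDerivAt y (hasFDerivAt_snd (𝕜 := ℂ))
    exact (h1.mul h2).const_mul (c n)
  · intro n y hy
    rw [mem_ball_zero_iff] at hy
    have h1 := (norm_fst_le y).trans hy.le
    have h2 := (norm_snd_le y).trans hy.le
    have key : ∀ (a b : ℂ) (p q : ℕ) (l : ℂ × ℂ →L[ℂ] ℂ), ‖l‖ ≤ 1 → ‖a‖ ≤ r → ‖b‖ ≤ r →
        ‖a ^ p • ((q * b ^ (q - 1)) • l)‖ ≤ q * r ^ (p + q) := by
      intro a b p q l hl ha hb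
      rw [norm_smul, norm_smul, norm_mul, norm_pow, norm_pow, Complex.norm_natCast]
      calc ‖a‖ ^ p * (q * ‖b‖ ^ (q - 1) * ‖l‖) ≤ r ^ p * (q * r ^ q * 1) := by
            gcongr
            exact (pow_le_pow_left₀ (norm_nonneg _) hb _).trans (pow_le_pow_right₀ hr1 (by omega))
        _ = q * r ^ (p + q) := by ring
    rw [norm_smul]
    have hadd := norm_add_le_of_le
      (key y.1 y.2 n.1 n.2 _ (ContinuousLinearMap.norm_snd_le ℂ ℂ ℂ) h1 h2)
      (key y.2 y.1 n.2 n.1 _ (ContinuousLinearMap.norm_fst_le ℂ ℂ ℂ) h2 h1)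
    have hlt : ((n.2 : ℝ) + n.1) ≤ 2 ^ (n.1 + n.2) := by
      have := (Nat.lt_two_pow_self (n := n.2 + n.1)).le
      rw [add_comm n.1 n.2]
      exact_mod_cast this
    calc _ ≤ M / (4 * r) ^ (n.1 + n.2) * (n.2 * r ^ (n.1 + n.2) + n.1 * r ^ (n.2 + n.1)) := by
          refine mul_le_mul (hM n) hadd (norm_nonneg _) (by positivity)
      _ = M / (4 * r) ^ (n.1 + n.2) * ((n.2 + n.1) * r ^ (n.1 + n.2)) := by
          rw [add_comm n.2 n.1]; ring
      _ ≤ M / (4 * r) ^ (n.1 + n.2) * (2 ^ (n.1 + n.2) * r ^ (n.1 + n.2)) := by gcongr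
      _ = M * (1 / 2) ^ (n.1 + n.2) := by
          have : (4 : ℝ) * r = 2 * (2 * r) := by ring
          rw [this, mul_pow, mul_pow 2 r, one_div, inv_pow]
          field_simp
  · obtain ⟨M', hM'⟩ := hc (2 * 1) (by norm_num)
    refine Summable.of_norm_bounded (hasSum_half_pow.summable.mul_left M') fun n => ?_
    exact norm_coeff_mul_monomial_le one_pos hM' (by simp) n

/-- The entire function with given Taylor coefficients. -/
def entireOfCoeff (c : ℕ × ℕ → ℂ) (hc : EntireCoeff c) : HC2 :=
  ⟨⟨fun y => ∑' n, c n * (monomial n.1 n.2).1 y, hc.differentiable.continuous⟩, hc.differentiable⟩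

lemma EntireCoeff.summable_norm {c : ℕ × ℕ → ℂ} (hc : EntireCoeff c) (y : ℂ × ℂ) :
    Summable fun n => ‖c n * (monomial n.1 n.2).1 y‖ := by
  have hr : 1 ≤ ‖y‖ + 1 := by linarith [norm_nonneg y]
  obtain ⟨M, hM⟩ := hc (2 * (‖y‖ + 1)) (by linarith)
  refine Summable.of_nonneg_of_le (fun n => norm_nonneg _) (fun n => ?_)
    (hasSum_half_pow.summable.mul_left M)
  exact norm_coeff_mul_monomial_le (by linarith) hM (by linarith) n

lemma hasSum_coe_iff {ι : Type*} {f : ι → HC2} {g : HC2} :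
    HasSum f g ↔ HasSum (fun i => (f i).1) g.1 :=
  (Topology.IsInducing.subtypeVal.hasSum_iff (g := HC2.subtype) f g).symm

lemma hasSum_entireOfCoeff {c : ℕ × ℕ → ℂ} (hc : EntireCoeff c) :
    HasSum (fun n : ℕ × ℕ => c n • monomial n.1 n.2) (entireOfCoeff c hc) := by
  rw [hasSum_coe_iff]
  have hs : Summable fun n : ℕ × ℕ => (c n • monomial n.1 n.2 : HC2).1 := by
    refine ContinuousMap.summable_of_locally_summable_norm fun K => ?_
    obtain ⟨r, hr⟩ := K.isCompact.isBounded.subset_closedBall (0 : ℂ × ℂ)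
    have hr1 : 1 ≤ max r 1 := le_max_right _ _
    obtain ⟨M, hM⟩ := hc (2 * max r 1) (by linarith)
    have hM0 : 0 ≤ M := by simpa using (norm_nonneg _).trans (hM (0, 0))
    refine Summable.of_nonneg_of_le (fun n => norm_nonneg _) (fun n => ?_)
      (hasSum_half_pow.summable.mul_left M)
    rw [ContinuousMap.norm_le _ (by positivity)]
    intro x
    refine norm_coeff_mul_monomial_le (by linarith) hM ?_ n
    exact (mem_closedBall_zero_iff.1 (hr x.2)).trans (le_max_left _ _)
  convert hs.hasSum using 1
  ext y
  rw [← ContinuousMap.tsum_apply hs y]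
  rfl

lemma entireCoeff_taylorCoeff (F : HC2) : EntireCoeff fun n => taylorCoeff F n.1 n.2 := by
  intro R hR
  obtain ⟨M, hM⟩ := (isCompact_closedBall (0 : ℂ × ℂ) R).exists_bound_of_continuousOn
    F.1.continuous.continuousOn
  exact ⟨M, fun n => norm_taylorCoeff_le F (by linarith) hM n.1 n.2⟩

/-- An entire function on `ℂ²` is the sum of its Taylor series at the origin. -/
lemma entireOfCoeff_taylorCoeff (F : HC2) :
    entireOfCoeff _ (entireCoeff_taylorCoeff F) = F := by
  apply Subtype.ext
  ext ⟨u, v⟩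
  have hs : Summable fun n : ℕ × ℕ => taylorCoeff F n.1 n.2 * (u ^ n.1 * v ^ n.2) :=
    ((entireCoeff_taylorCoeff F).summable_norm (u, v)).of_norm
  change ∑' n : ℕ × ℕ, taylorCoeff F n.1 n.2 * (u ^ n.1 * v ^ n.2) = F.1 (u, v)
  have hd : Differentiable ℂ fun v => F.1 (u, v) := Differentiable.comp F.2 (by fun_prop)
  -- The indices are swapped so that the outer sum runs over powers of `v`: its coefficients are
  -- entire functions of `u`, each then expanded in turn.
  have hs' := (Equiv.prodComm ℕ ℕ).summable_iff.2 hs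
  rw [← (Equiv.prodComm ℕ ℕ).tsum_eq]
  refine hs'.tsum_prod.trans ?_
  rw [← Complex.taylorSeries_eq_of_entire' 0 v hd]
  refine tsum_congr fun q => ?_
  rw [← Complex.taylorSeries_eq_of_entire' 0 u (differentiable_iteratedDeriv_snd F.2 q),
    ← tsum_mul_left, ← tsum_mul_right]
  refine tsum_congr fun p => ?_
  simp only [Function.comp, Equiv.prodComm_apply, Prod.fst_swap, Prod.snd_swap, taylorCoeff,
    sub_zero]
  field_simp

lemma hasSum_taylorTerm (F : HC2) : HasSum (taylorTerm F) F := by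
  have := hasSum_entireOfCoeff (entireCoeff_taylorCoeff F)
  rwa [entireOfCoeff_taylorCoeff] at this

/-! ### Algebra of Taylor coefficients -/

lemma differentiable_slice (F : HC2) (u : ℂ) : Differentiable ℂ fun v => F.1 (u, v) :=
  Differentiable.comp F.2 (by fun_prop)

lemma taylorCoeff_add (F G : HC2) (p q : ℕ) :
    taylorCoeff (F + G) p q = taylorCoeff F p q + taylorCoeff G p q := by
  have h : ∀ u, iteratedDeriv q (fun v => (F + G).1 (u, v)) 0 =
      iteratedDeriv q (fun v => F.1 (u, v)) 0 + iteratedDeriv q (fun v => G.1 (u, v)) 0 := fun u =>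
    iteratedDeriv_fun_add (differentiable_slice F u).contDiff.contDiffAt
      (differentiable_slice G u).contDiff.contDiffAt
  simp only [taylorCoeff, h]
  rw [iteratedDeriv_fun_add (differentiable_iteratedDeriv_snd F.2 q).contDiff.contDiffAt
    (differentiable_iteratedDeriv_snd G.2 q).contDiff.contDiffAt, add_div]

lemma taylorCoeff_smul (c : ℂ) (F : HC2) (p q : ℕ) :
    taylorCoeff (c • F) p q = c * taylorCoeff F p q := by
  have h : ∀ u, iteratedDeriv q (fun v => (c • F).1 (u, v)) 0 =
      c * iteratedDeriv q (fun v => F.1 (u, v)) 0 := fun u =>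
    iteratedDeriv_const_mul_field c (fun v => F.1 (u, v))
  simp only [taylorCoeff, h]
  rw [iteratedDeriv_const_mul_field, mul_div_assoc]

lemma taylorCoeff_monomial (p q m n : ℕ) :
    taylorCoeff (monomial p q) m n = if (m, n) = (p, q) then 1 else 0 := by
  have h : ∀ u : ℂ, iteratedDeriv n (fun v => (monomial p q).1 (u, v)) 0 =
      (if n = q then (q.factorial : ℂ) else 0) * u ^ p := by
    intro u
    change iteratedDeriv n (fun v => u ^ p * v ^ q) 0 = _
    rw [iteratedDeriv_const_mul_field, iteratedDeriv_fun_pow_zero, mul_comm]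
    split_ifs <;> simp
  simp only [taylorCoeff, h]
  rw [iteratedDeriv_const_mul_field, iteratedDeriv_fun_pow_zero]
  have hp : (p.factorial : ℂ) ≠ 0 := mod_cast p.factorial_ne_zero
  have hq : (q.factorial : ℂ) ≠ 0 := mod_cast q.factorial_ne_zero
  by_cases hm : m = p <;> by_cases hn : n = q <;> simp [hm, hn]
  field_simp

/-! ### Continuous operators that rearrange Taylor coefficients -/

/-- The coefficients of `F` along the index map `τ`, restricted to the set `A`. -/
def reindexCoeff (A : Set (ℕ × ℕ)) (τ : ℕ × ℕ → ℕ × ℕ) (F : HC2) : ℕ × ℕ → ℂ :=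
  A.indicator fun n => taylorCoeff F (τ n).1 (τ n).2

section Reindex

variable (A : Set (ℕ × ℕ)) (τ : ℕ × ℕ → ℕ × ℕ) (hτ : ∀ n, n.1 + n.2 ≤ (τ n).1 + (τ n).2)

-- Since `τ` does not lower the total degree and `1 ≤ R`, the Cauchy bound at `τ n` is at least as
-- good as the one at `n`.
include hτ in
lemma norm_reindexCoeff_le (F : HC2) {R M : ℝ} (hR : 1 ≤ R)
    (hM : ∀ y ∈ closedBall (0 : ℂ × ℂ) R, ‖F.1 y‖ ≤ M) (n : ℕ × ℕ) :
    ‖reindexCoeff A τ F n‖ ≤ M / R ^ (n.1 + n.2) := by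
  have hM0 : 0 ≤ M := (norm_nonneg _).trans (hM 0 (mem_closedBall_self (by linarith)))
  refine (norm_indicator_le_norm_self _ _).trans
    ((norm_taylorCoeff_le F (by linarith) hM _ _).trans ?_)
  exact div_le_div_of_nonneg_left hM0 (by positivity) (pow_le_pow_right₀ hR (hτ n))

include hτ in
lemma entireCoeff_reindexCoeff (F : HC2) : EntireCoeff (reindexCoeff A τ F) := by
  intro R hR
  obtain ⟨M, hM⟩ := (isCompact_closedBall (0 : ℂ × ℂ) R).exists_bound_of_continuousOn
    F.1.continuous.continuousOn
  exact ⟨M, norm_reindexCoeff_le A τ hτ F hR hM⟩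

lemma reindexCoeff_add (F G : HC2) :
    reindexCoeff A τ (F + G) = reindexCoeff A τ F + reindexCoeff A τ G := by
  simp only [reindexCoeff, taylorCoeff_add]
  exact Set.indicator_add' A _ _

lemma reindexCoeff_smul (c : ℂ) (F : HC2) :
    reindexCoeff A τ (c • F) = c • reindexCoeff A τ F := by
  simp only [reindexCoeff, taylorCoeff_smul]
  exact Set.indicator_const_smul A c _

/-- The operator on entire functions that reindexes the Taylor coefficients along `τ`, as a linear
map. -/
def reindexLinear : HC2 →ₗ[ℂ] HC2 where
  toFun F := entireOfCoeff _ (entireCoeff_reindexCoeff A τ hτ F)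
  map_add' F G := by
    refine (hasSum_entireOfCoeff _).unique ?_
    convert (hasSum_entireOfCoeff (entireCoeff_reindexCoeff A τ hτ F)).add
      (hasSum_entireOfCoeff (entireCoeff_reindexCoeff A τ hτ G)) using 2 with n
    rw [reindexCoeff_add, Pi.add_apply, add_smul]
  map_smul' c F := by
    rw [RingHom.id_apply]
    refine (hasSum_entireOfCoeff _).unique ?_
    convert (hasSum_entireOfCoeff (entireCoeff_reindexCoeff A τ hτ F)).const_smul c using 2 with n
    rw [reindexCoeff_smul, Pi.smul_apply, smul_assoc]

/-- Doubling the radius makes the terms geometric, and 4 is the sum of `(1 / 2) ^ (n.1 + n.2)`. The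
constant does not depend on `F`, which gives continuity. -/
lemma norm_reindexLinear_le (F : HC2) {r M : ℝ} (hr : 1 ≤ r)
    (hM : ∀ y ∈ closedBall (0 : ℂ × ℂ) (2 * r), ‖F.1 y‖ ≤ M) {y : ℂ × ℂ} (hy : ‖y‖ ≤ r) :
    ‖(reindexLinear A τ hτ F).1 y‖ ≤ M * 4 :=
  tsum_of_norm_bounded (hasSum_half_pow.mul_left M) fun n =>
    norm_coeff_mul_monomial_le (by linarith)
      (norm_reindexCoeff_le A τ hτ F (by linarith) hM) hy n

lemma continuous_reindexLinear : Continuous (reindexLinear A τ hτ) := by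
  refine continuous_of_continuousAt_zero _ ?_
  rw [ContinuousAt, map_zero, tendsto_subtype_rng,
    ContinuousMap.tendsto_iff_forall_isCompact_tendstoUniformlyOn]
  intro K hK
  obtain ⟨r, hr⟩ := hK.isBounded.subset_closedBall (0 : ℂ × ℂ)
  rw [Metric.tendstoUniformlyOn_iff]
  intro ε hε
  -- The operator loses a factor 4, so `ε / 5` ends strictly below `ε`.
  have hU : ∀ᶠ g : C(ℂ × ℂ, ℂ) in 𝓝 (0 : HC2).1,
      Set.MapsTo g (closedBall (0 : ℂ × ℂ) (2 * max r 1)) (ball 0 (ε / 5)) :=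
    ContinuousMap.eventually_mapsTo (isCompact_closedBall _ _) isOpen_ball fun y _ =>
      mem_ball_self (by positivity)
  filter_upwards [continuous_subtype_val.continuousAt.eventually hU] with F hF y hy
  have := norm_reindexLinear_le A τ hτ F (le_max_right r 1) (M := ε / 5)
    (fun z hz => (mem_ball_zero_iff.1 (hF hz)).le)
    ((mem_closedBall_zero_iff.1 (hr hy)).trans (le_max_left r 1))
  change dist 0 ((reindexLinear A τ hτ F).1 y) < ε
  rw [dist_zero_left]
  linarith

/-- The operator on entire functions that reindexes the Taylor coefficients along `τ`. -/
def reindexOp : HC2 →L[ℂ] HC2 := ⟨reindexLinear A τ hτ, continuous_reindexLinear A τ hτ⟩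

lemma hasSum_reindexOp (F : HC2) :
    HasSum (fun n => reindexCoeff A τ F n • monomial n.1 n.2) (reindexOp A τ hτ F) :=
  hasSum_entireOfCoeff (entireCoeff_reindexCoeff A τ hτ F)

lemma reindexOp_monomial {m : ℕ × ℕ} (hm : m ∈ A) (hinj : Function.Injective τ) {p q : ℕ}
    (h : τ m = (p, q)) : reindexOp A τ hτ (monomial p q) = monomial m.1 m.2 := by
  refine (hasSum_reindexOp A τ hτ _).unique ?_
  convert hasSum_ite_eq m (monomial m.1 m.2) using 2 with n
  by_cases hn : n = m
  · subst hn
    simp [reindexCoeff, hm, taylorCoeff_monomial, h]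
  · have : τ n ≠ (p, q) := fun h' => hn (hinj (h'.trans h.symm))
    simp [reindexCoeff, Set.indicator, taylorCoeff_monomial, this, hn]

end Reindex

/-! ### The projections onto past and future -/

/-- The projection `π₊` as a continuous linear operator. -/
def projPlusL : HC2 →L[ℂ] HC2 := reindexOp {n | n.2 ≤ n.1} id fun _ => le_rfl

/-- The projection `π₋` as a continuous linear operator. -/
def projMinusL : HC2 →L[ℂ] HC2 := reindexOp {n | n.1 < n.2} id fun _ => le_rfl

lemma hasSum_subtype_taylorTerm (A : Set (ℕ × ℕ)) (F : HC2) :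
    HasSum (fun n : A => taylorTerm F n) (reindexOp A id (fun _ => le_rfl) F) := by
  have := hasSum_reindexOp A id (fun _ => le_rfl) F
  rw [← Function.comp_def (taylorTerm F), hasSum_subtype_iff_indicator]
  convert this using 2 with n
  by_cases hn : n ∈ A <;> simp [reindexCoeff, taylorTerm, hn]

lemma coe_projPlus (F : HC2) : (projPlus F : HC2) = projPlusL F :=
  (hasSum_subtype_taylorTerm {n | n.2 ≤ n.1} F).tsum_eq

lemma coe_projMinus (F : HC2) : (projMinus F : HC2) = projMinusL F :=
  (hasSum_subtype_taylorTerm {n | n.1 < n.2} F).tsum_eq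

lemma projPlusL_add_projMinusL (F : HC2) : projPlusL F + projMinusL F = F := by
  refine ((hasSum_reindexOp _ _ _ F).add (hasSum_reindexOp _ _ _ F)).unique ?_
  convert hasSum_taylorTerm F using 2 with n
  by_cases hn : n.2 ≤ n.1
  · simp [reindexCoeff, taylorTerm, Set.indicator, hn]
  · simp [reindexCoeff, taylorTerm, Set.indicator, hn, not_le.1 hn]

lemma monomial_mem_HC2Plus {p q : ℕ} (h : q ≤ p) : monomial p q ∈ HC2Plus :=
  Submodule.le_topologicalClosure _ (Submodule.subset_span ⟨p, q, h, rfl⟩)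

lemma monomial_mem_HC2Minus {p q : ℕ} (h : p < q) : monomial p q ∈ HC2Minus :=
  Submodule.le_topologicalClosure _ (Submodule.subset_span ⟨p, q, h, rfl⟩)

section Ext

variable {E : Type*} [TopologicalSpace E] [AddCommMonoid E] [Module ℂ E] [T2Space E]

lemma eq_of_mem_HC2Plus {S T : HC2 →L[ℂ] E}
    (h : ∀ p q, q ≤ p → S (monomial p q) = T (monomial p q)) {F : HC2} (hF : F ∈ HC2Plus) :
    S F = T F :=
  ContinuousLinearMap.eqOn_closure_span
    (by rintro _ ⟨p, q, hpq, rfl⟩; exact h p q hpq) hF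

lemma eq_of_mem_HC2Minus {S T : HC2 →L[ℂ] E}
    (h : ∀ p q, p < q → S (monomial p q) = T (monomial p q)) {F : HC2} (hF : F ∈ HC2Minus) :
    S F = T F :=
  ContinuousLinearMap.eqOn_closure_span
    (by rintro _ ⟨p, q, hpq, rfl⟩; exact h p q hpq) hF

end Ext

lemma projPlusL_of_mem_plus {F : HC2} (hF : F ∈ HC2Plus) : projPlusL F = F :=
  eq_of_mem_HC2Plus (T := .id ℂ HC2) (fun _ _ h =>
    reindexOp_monomial _ _ _ (m := (_, _)) h Function.injective_id rfl) hF

lemma projMinusL_of_mem_minus {F : HC2} (hF : F ∈ HC2Minus) : projMinusL F = F :=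
  eq_of_mem_HC2Minus (T := .id ℂ HC2) (fun _ _ h =>
    reindexOp_monomial _ _ _ (m := (_, _)) h Function.injective_id rfl) hF

lemma projMinusL_of_mem_plus {F : HC2} (hF : F ∈ HC2Plus) : projMinusL F = 0 := by
  have := projPlusL_add_projMinusL F
  rwa [projPlusL_of_mem_plus hF, add_eq_left] at this

lemma projPlusL_of_mem_minus {F : HC2} (hF : F ∈ HC2Minus) : projPlusL F = 0 := by
  have := projPlusL_add_projMinusL F
  rwa [projMinusL_of_mem_minus hF, add_eq_right] at this

lemma projPlusL_mem (F : HC2) : projPlusL F ∈ HC2Plus := coe_projPlus F ▸ (projPlus F).2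

lemma projMinusL_mem (F : HC2) : projMinusL F ∈ HC2Minus := coe_projMinus F ▸ (projMinus F).2

/-! ### The extension operators -/

/-- The reindexing that turns `u ^ p * v ^ q` with `q ≤ p` into `u ^ (p - q) * v ^ q`. -/
def shearPlus : HC2 →L[ℂ] HC2 :=
  reindexOp Set.univ (fun n => (n.1 + n.2, n.2)) fun n => by dsimp only; omega

/-- The reindexing that turns `u ^ p * v ^ q` with `p ≤ q` into `u ^ (q - p) * v ^ p`. -/
def shearMinus : HC2 →L[ℂ] HC2 :=
  reindexOp Set.univ (fun n => (n.2, n.1 + n.2)) fun n => by dsimp only; omega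

lemma shearPlus_monomial {p q : ℕ} (h : q ≤ p) :
    shearPlus (monomial p q) = monomial (p - q) q := by
  refine reindexOp_monomial _ _ _ (m := (p - q, q)) (Set.mem_univ _) ?_ (by simp [h])
  rintro ⟨a, b⟩ ⟨c, d⟩ hab
  simp only [Prod.mk.injEq] at hab ⊢
  omega

lemma shearMinus_monomial {p q : ℕ} (h : p ≤ q) :
    shearMinus (monomial p q) = monomial (q - p) p := by
  refine reindexOp_monomial _ _ _ (m := (q - p, p)) (Set.mem_univ _) ?_ (by simp [h])
  rintro ⟨a, b⟩ ⟨c, d⟩ hab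
  simp only [Prod.mk.injEq] at hab ⊢
  omega

/-- Here `max p q = p = (p - q) + q`, so the denominator splits along with the numerator, in either
chart. This is what makes `Φ₊` a substitution into an entire function. -/
lemma fpq_eq_of_le {p q : ℕ} (h : q ≤ p) (x : Omega) :
    (fpq p q).1 x = (fpq 1 0).1 x ^ (p - q) * (fpq 1 1).1 x ^ q := by
  obtain ⟨k, rfl⟩ := Nat.exists_eq_add_of_le h
  change fpqFun _ _ _ _ = fpqFun 1 0 _ _ ^ _ * fpqFun 1 1 _ _ ^ _
  rcases Omega.cases x with ⟨h1, h2⟩ | ⟨h1, h2⟩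
  · have h0 := one_sub_ne h1 h2
    simp only [fpqFun_finite _ _ h1 h2]
    simp [div_pow, mul_pow, pow_add]
    field_simp
  · have h0 := recip_sub_one_ne h1 h2
    simp only [fpqFun_ne_zero _ _ h1 h2]
    simp [div_pow, pow_add]
    field_simp

lemma fpq_eq_of_ge {p q : ℕ} (h : p ≤ q) (x : Omega) :
    (fpq p q).1 x = (fpq 0 1).1 x ^ (q - p) * (fpq 1 1).1 x ^ p := by
  obtain ⟨k, rfl⟩ := Nat.exists_eq_add_of_le h
  change fpqFun _ _ _ _ = fpqFun 0 1 _ _ ^ _ * fpqFun 1 1 _ _ ^ _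
  rcases Omega.cases x with ⟨h1, h2⟩ | ⟨h1, h2⟩
  · have h0 := one_sub_ne h1 h2
    simp only [fpqFun_finite _ _ h1 h2]
    simp [div_pow, mul_pow, pow_add]
    field_simp
  · have h0 := recip_sub_one_ne h1 h2
    simp only [fpqFun_ne_zero _ _ h1 h2]
    simp [div_pow, pow_add]
    field_simp

lemma isHolomorphic_comp (G : HC2) (f g : HOmega) :
    IsHolomorphic fun x => G.1 (f.1 x, g.1 x) := by
  have key : ∀ e : chartTarget → Omega,
      DifferentiableOn ℂ (extendZero fun y => f.1 (e y)) chartTarget →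
      DifferentiableOn ℂ (extendZero fun y => g.1 (e y)) chartTarget →
      DifferentiableOn ℂ (extendZero fun y => G.1 (f.1 (e y), g.1 (e y))) chartTarget := by
    intro e hf hg
    have hG : Differentiable ℂ G.1 := G.2
    refine (hG.comp_differentiableOn (hf.prodMk hg)).congr fun y hy => ?_
    simp only [Function.comp, extendZero, hy, dite_true]
  exact ⟨key stdInv f.2.1 g.2.1, key flipInv f.2.2 g.2.2⟩

/-- Substitution of two holomorphic functions on `Ω` into an entire function. -/
def substOp (f g : HOmega) : HC2 →L[ℂ] HOmega where
  toFun G := ⟨G.1.comp (f.1.prodMk g.1), isHolomorphic_comp G f g⟩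
  map_add' _ _ := rfl
  map_smul' _ _ := rfl
  cont := ((ContinuousMap.continuous_precomp _).comp continuous_subtype_val).subtype_mk _

/-- The extension operator `Φ₊`, defined on all of `H(ℂ²)`. -/
def extPlus : HC2 →L[ℂ] HOmega := (substOp (fpq 1 0) (fpq 1 1)).comp shearPlus

/-- The extension operator `Φ₋`, defined on all of `H(ℂ²)`. -/
def extMinus : HC2 →L[ℂ] HOmega := (substOp (fpq 0 1) (fpq 1 1)).comp shearMinus

lemma extPlus_monomial {p q : ℕ} (h : q ≤ p) : extPlus (monomial p q) = fpq p q := by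
  rw [extPlus, ContinuousLinearMap.comp_apply, shearPlus_monomial h]
  apply Subtype.ext
  ext x
  exact (fpq_eq_of_le h x).symm

lemma extMinus_monomial {p q : ℕ} (h : p ≤ q) : extMinus (monomial p q) = fpq p q := by
  rw [extMinus, ContinuousLinearMap.comp_apply, shearMinus_monomial h]
  apply Subtype.ext
  ext x
  exact (fpq_eq_of_ge h x).symm

lemma fpq_mem_HOmegaPlus {p q : ℕ} (h : q ≤ p) : fpq p q ∈ HOmegaPlus :=
  Submodule.le_topologicalClosure _ (Submodule.subset_span ⟨p, q, h, rfl⟩)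

lemma fpq_mem_HOmegaMinus {p q : ℕ} (h : p < q) : fpq p q ∈ HOmegaMinus :=
  Submodule.le_topologicalClosure _ (Submodule.subset_span ⟨p, q, h, rfl⟩)

lemma extPlus_mem {F : HC2} (hF : F ∈ HC2Plus) : extPlus F ∈ HOmegaPlus := by
  have hle : HC2Plus ≤ HOmegaPlus.comap (extPlus : HC2 →ₗ[ℂ] HOmega) := by
    refine Submodule.topologicalClosure_minimal _ (Submodule.span_le.2 ?_)
      ((Submodule.isClosed_topologicalClosure _).preimage extPlus.continuous)
    rintro _ ⟨p, q, h, rfl⟩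
    change extPlus (monomial p q) ∈ HOmegaPlus
    rw [extPlus_monomial h]
    exact fpq_mem_HOmegaPlus h
  exact hle hF

lemma extMinus_mem {F : HC2} (hF : F ∈ HC2Minus) : extMinus F ∈ HOmegaMinus := by
  have hle : HC2Minus ≤ HOmegaMinus.comap (extMinus : HC2 →ₗ[ℂ] HOmega) := by
    refine Submodule.topologicalClosure_minimal _ (Submodule.span_le.2 ?_)
      ((Submodule.isClosed_topologicalClosure _).preimage extMinus.continuous)
    rintro _ ⟨p, q, h, rfl⟩
    change extMinus (monomial p q) ∈ HOmegaMinus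
    rw [extMinus_monomial h.le]
    exact fpq_mem_HOmegaMinus h
  exact hle hF

/-! ### Pullback along the inverses of `Ψ₊` and `Ψ₋` -/

lemma continuousAt_sphereInv_zero : ContinuousAt (fun z : ℂ => sphereInv (z : OnePoint ℂ)) 0 := by
  rw [continuousAt_iff_punctured_nhds]
  have h0 : sphereInv ((0 : ℂ) : OnePoint ℂ) = ∞ := by simp [sphereInv]
  rw [h0]
  have h1 : Filter.Tendsto (fun z : ℂ => ((z⁻¹ : ℂ) : OnePoint ℂ)) (𝓝[≠] 0) (𝓝 ∞) := by
    refine OnePoint.tendsto_coe_infty.comp ?_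
    rw [Filter.coclosedCompact_eq_cocompact, ← Metric.cobounded_eq_cocompact]
    exact Filter.tendsto_inv₀_nhdsNE_zero
  refine h1.congr' ?_
  filter_upwards [self_mem_nhdsWithin] with z hz
  have : z ≠ 0 := hz
  simp [sphereInv, this]

/-- Where `u * v = -1` the value is `∞`; there `u ≠ 0`, and the map is the inversion of `(1 + u * v)
/ u`, which is continuous. -/
lemma continuous_quotInv : Continuous fun y : ℂ × ℂ => quotInv y.1 y.2 := by
  rw [continuous_iff_continuousAt]
  rintro ⟨u, v⟩
  by_cases h : 1 + u * v = 0
  · have hu : u ≠ 0 := by rintro rfl; simp at h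
    have hc : ContinuousAt (fun y : ℂ × ℂ => (1 + y.1 * y.2) / y.1) (u, v) :=
      ContinuousAt.div (by fun_prop) (by fun_prop) hu
    have h0 : (1 + (u, v).1 * (u, v).2) / (u, v).1 = 0 := by simp [h]
    refine (ContinuousAt.comp_of_eq continuousAt_sphereInv_zero hc h0).congr ?_
    filter_upwards [(continuous_fst.continuousAt (x := (u, v))).eventually_ne hu] with y hy
    exact (quotInv_eq_sphereInv hy).symm
  · have hc : ContinuousAt (fun y : ℂ × ℂ => y.1 / (1 + y.1 * y.2)) (u, v) :=
      ContinuousAt.div (by fun_prop) (by fun_prop) h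
    refine (OnePoint.continuous_coe.continuousAt.comp hc).congr ?_
    have c : Continuous fun y : ℂ × ℂ => 1 + y.1 * y.2 := by fun_prop
    filter_upwards [(c.continuousAt (x := (u, v))).eventually_ne h] with y hy
    simp [quotInv, hy]

lemma continuous_psiPlus_symm : Continuous fun y => (psiPlus.symm y).1 :=
  (continuous_quotInv.prodMk (OnePoint.continuous_coe.comp continuous_snd)).subtype_mk _

lemma continuous_psiMinus_symm : Continuous fun y => (psiMinus.symm y).1 :=
  ((OnePoint.continuous_coe.comp continuous_fst).prodMk
    (continuous_quotInv.comp continuous_swap)).subtype_mk _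

/-- The operator `f ↦ f ∘ Ψ₊⁻¹`. -/
def compPlusL : HOmega →L[ℂ] HC2 where
  toFun := compPsiPlusInv
  map_add' _ _ := rfl
  map_smul' _ _ := rfl
  cont := ((ContinuousMap.continuous_precomp ⟨_, continuous_psiPlus_symm⟩).comp
    continuous_subtype_val).subtype_mk _

/-- The operator `f ↦ f ∘ Ψ₋⁻¹`. -/
def compMinusL : HOmega →L[ℂ] HC2 where
  toFun := compPsiMinusInv
  map_add' _ _ := rfl
  map_smul' _ _ := rfl
  cont := ((ContinuousMap.continuous_precomp ⟨_, continuous_psiMinus_symm⟩).comp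
    continuous_subtype_val).subtype_mk _

lemma neg_inv_of_one_add_mul {u v : ℂ} (h : 1 + u * v = 0) : -v⁻¹ = u := by
  have hv : v ≠ 0 := by rintro rfl; simp at h
  field_simp
  linear_combination -h

section Values

variable (u v : ℂ)

lemma fpqFun_one_zero_quotInv : fpqFun 1 0 (quotInv u v) v = u := by
  by_cases h : 1 + u * v = 0
  · simp [quotInv, h, fpqFun, div_neg, neg_inv_of_one_add_mul h]
  · have := quot_quotInv u v
    simp only [quotInv, h, if_false, quot] at this ⊢
    simpa [fpqFun] using this

lemma fpqFun_one_one_quotInv : fpqFun 1 1 (quotInv u v) v = u * v := by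
  by_cases h : 1 + u * v = 0
  · simp only [quotInv, h, if_true, fpqFun]
    simp only [max_self, tsub_self, pow_zero, mul_one, recip_infty, mul_zero, zero_sub, pow_one]
    linear_combination -h
  · have := quot_quotInv u v
    simp only [quotInv, h, if_false, quot] at this ⊢
    simp only [fpqFun, max_self, pow_one]
    rw [mul_div_right_comm, this]

lemma fpqFun_zero_one_quotInv : fpqFun 0 1 (quotInv u v) v = v * (1 + u * v) := by
  by_cases h : 1 + u * v = 0
  · simp [quotInv, h, fpqFun]
  · simp only [quotInv, h, if_false, fpqFun]
    have : 1 - u / (1 + u * v) * v = 1 / (1 + u * v) := by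
      field_simp
      ring
    simp [this]

lemma fpqFun_comm (p q : ℕ) (x y : OnePoint ℂ) : fpqFun p q x y = fpqFun q p y x := by
  have key : ∀ (a b c : ℂ) (k l m : ℕ),
      a ^ k * b ^ l / (a * b - c) ^ m = b ^ l * a ^ k / (b * a - c) ^ m := by
    intros; ring
  induction x using OnePoint.rec <;> induction y using OnePoint.rec <;>
    simp only [fpqFun, max_comm p q]
  · exact key _ _ _ _ _ _
  · exact key _ _ _ _ _ _
  · exact key _ _ _ _ _ _
  · ring

end Values

lemma compPlusL_fpq {p q : ℕ} (h : q ≤ p) : compPlusL (fpq p q) = monomial p q := by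
  apply Subtype.ext
  ext ⟨u, v⟩
  change (fpq p q).1 (psiPlus.symm (u, v)).1 = u ^ p * v ^ q
  rw [fpq_eq_of_le h]
  change fpqFun 1 0 (quotInv u v) v ^ _ * fpqFun 1 1 (quotInv u v) v ^ _ = _
  rw [fpqFun_one_zero_quotInv, fpqFun_one_one_quotInv, mul_pow, ← mul_assoc, ← pow_add,
    Nat.sub_add_cancel h]

lemma compMinusL_fpq {p q : ℕ} (h : p ≤ q) : compMinusL (fpq p q) = monomial p q := by
  apply Subtype.ext
  ext ⟨u, v⟩
  change (fpq p q).1 (psiMinus.symm (u, v)).1 = u ^ p * v ^ q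
  rw [fpq_eq_of_ge h]
  change fpqFun 0 1 u (quotInv v u) ^ _ * fpqFun 1 1 u (quotInv v u) ^ _ = _
  rw [fpqFun_comm, fpqFun_comm 1 1, fpqFun_one_zero_quotInv, fpqFun_one_one_quotInv, mul_pow,
    ← mul_assoc, ← pow_add, Nat.sub_add_cancel h, mul_comm]

/-- In the wrong chart `f_{p,q}` is `(u * (1 + u * v)) ^ (p - q) * (u * v) ^ q`; the binomial
theorem raises both exponents by the same `k`, so the future is preserved. -/
lemma compMinusL_fpq_mem {p q : ℕ} (h : q ≤ p) : compMinusL (fpq p q) ∈ HC2Plus := by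
  have : compMinusL (fpq p q) =
      ∑ k ∈ Finset.range (p - q + 1), ((p - q).choose k : ℂ) • monomial (p + k) (q + k) := by
    apply Subtype.ext
    ext ⟨u, v⟩
    rw [AddSubmonoidClass.coe_finsetSum, ContinuousMap.sum_apply]
    change (fpq p q).1 (psiMinus.symm (u, v)).1 =
      ∑ k ∈ Finset.range (p - q + 1), ((p - q).choose k : ℂ) * (u ^ (p + k) * v ^ (q + k))
    rw [fpq_eq_of_le h]
    change fpqFun 1 0 u (quotInv v u) ^ _ * fpqFun 1 1 u (quotInv v u) ^ _ = _
    rw [fpqFun_comm, fpqFun_comm 1 1, fpqFun_zero_one_quotInv, fpqFun_one_one_quotInv, mul_pow,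
      add_comm 1, add_pow, Finset.mul_sum, Finset.sum_mul]
    refine Finset.sum_congr rfl fun k _ => ?_
    obtain ⟨d, rfl⟩ := Nat.exists_eq_add_of_le h
    rw [Nat.add_sub_cancel_left, one_pow]
    ring
  rw [this]
  exact Submodule.sum_mem _ fun k _ =>
    Submodule.smul_mem _ _ (monomial_mem_HC2Plus (Nat.add_le_add_right h k))

lemma compPlusL_fpq_mem {p q : ℕ} (h : p < q) : compPlusL (fpq p q) ∈ HC2Minus := by
  have : compPlusL (fpq p q) =
      ∑ k ∈ Finset.range (q - p + 1), ((q - p).choose k : ℂ) • monomial (p + k) (q + k) := by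
    apply Subtype.ext
    ext ⟨u, v⟩
    rw [AddSubmonoidClass.coe_finsetSum, ContinuousMap.sum_apply]
    change (fpq p q).1 (psiPlus.symm (u, v)).1 =
      ∑ k ∈ Finset.range (q - p + 1), ((q - p).choose k : ℂ) * (u ^ (p + k) * v ^ (q + k))
    rw [fpq_eq_of_ge h.le]
    change fpqFun 0 1 (quotInv u v) v ^ _ * fpqFun 1 1 (quotInv u v) v ^ _ = _
    rw [fpqFun_zero_one_quotInv, fpqFun_one_one_quotInv, mul_pow,
      add_comm 1, add_pow, Finset.mul_sum, Finset.sum_mul]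
    refine Finset.sum_congr rfl fun k _ => ?_
    obtain ⟨d, rfl⟩ := Nat.exists_eq_add_of_le h.le
    rw [Nat.add_sub_cancel_left, one_pow]
    ring
  rw [this]
  exact Submodule.sum_mem _ fun k _ =>
    Submodule.smul_mem _ _ (monomial_mem_HC2Minus (Nat.add_lt_add_right h k))

lemma compPlusL_extPlus {F : HC2} (hF : F ∈ HC2Plus) : compPlusL (extPlus F) = F :=
  eq_of_mem_HC2Plus (S := compPlusL.comp extPlus) (T := .id ℂ HC2) (fun _ _ h => by
    rw [ContinuousLinearMap.comp_apply, extPlus_monomial h, compPlusL_fpq h]; rfl) hF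

lemma compMinusL_extMinus {F : HC2} (hF : F ∈ HC2Minus) : compMinusL (extMinus F) = F :=
  eq_of_mem_HC2Minus (S := compMinusL.comp extMinus) (T := .id ℂ HC2) (fun _ _ h => by
    rw [ContinuousLinearMap.comp_apply, extMinus_monomial h.le, compMinusL_fpq h.le]; rfl) hF

lemma projMinusL_compMinusL_extPlus {F : HC2} (hF : F ∈ HC2Plus) :
    projMinusL (compMinusL (extPlus F)) = 0 :=
  eq_of_mem_HC2Plus (S := projMinusL.comp (compMinusL.comp extPlus)) (T := 0) (fun _ _ h => by
    rw [ContinuousLinearMap.comp_apply, ContinuousLinearMap.comp_apply, extPlus_monomial h,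
      projMinusL_of_mem_plus (compMinusL_fpq_mem h)]; rfl) hF

lemma projPlusL_compPlusL_extMinus {F : HC2} (hF : F ∈ HC2Minus) :
    projPlusL (compPlusL (extMinus F)) = 0 :=
  eq_of_mem_HC2Minus (S := projPlusL.comp (compPlusL.comp extMinus)) (T := 0) (fun _ _ h => by
    rw [ContinuousLinearMap.comp_apply, ContinuousLinearMap.comp_apply, extMinus_monomial h.le,
      projPlusL_of_mem_minus (compPlusL_fpq_mem h)]; rfl) hF

/-! ### Uniqueness of holomorphic extensions -/

lemma compPlusL_stdInv (f : HOmega) (y : chartTarget) :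
    (compPlusL f).1 (y.1.1 / (1 - y.1.1 * y.1.2), y.1.2) = f.1 (stdInv y) :=
  congrArg (fun x : OmegaPlus => f.1 x.1)
    (psiPlus.symm_apply_apply ⟨stdInv y, OnePoint.coe_ne_infty _⟩)

lemma compMinusL_stdInv (f : HOmega) (y : chartTarget) :
    (compMinusL f).1 (y.1.1, y.1.2 / (1 - y.1.2 * y.1.1)) = f.1 (stdInv y) :=
  congrArg (fun x : OmegaMinus => f.1 x.1)
    (psiMinus.symm_apply_apply ⟨stdInv y, OnePoint.coe_ne_infty _⟩)

lemma sphereInv_recip {x : OnePoint ℂ} (hx : x ≠ ((0 : ℂ) : OnePoint ℂ)) :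
    sphereInv (recip x : OnePoint ℂ) = x := by
  induction x using OnePoint.rec with
  | infty => simp [sphereInv]
  | coe z =>
    have hz : z ≠ 0 := fun h => hx (by rw [h])
    exact sphereInv_inv hz

/-- A holomorphic function on `Ω` that vanishes at all finite points is zero. -/
lemma eq_zero_of_forall_stdInv {f : HOmega} (hf : ∀ y, f.1 (stdInv y) = 0) : f = 0 := by
  have hflip : ∀ y : chartTarget, y.1.1 ≠ 0 → y.1.2 ≠ 0 → f.1 (flipInv y) = 0 := by
    rintro ⟨⟨a, b⟩, hab⟩ ha hb
    have hmem : ((b⁻¹, a⁻¹) : ℂ × ℂ) ∈ chartTarget := by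
      intro h
      apply hab
      change b⁻¹ * a⁻¹ = 1 at h
      rw [← mul_inv, inv_eq_one] at h
      rw [← h, mul_comm]
    rw [← hf ⟨_, hmem⟩]
    congr 1
    apply Subtype.ext
    have ha' : a ≠ 0 := ha
    have hb' : b ≠ 0 := hb
    simp [flipInv, stdInv, sphereInv, ha', hb']
  have hflip' : ∀ y : chartTarget, f.1 (flipInv y) = 0 := by
    rintro ⟨y, hy⟩
    have hc : ContinuousAt (extendZero fun y => f.1 (flipInv y)) y :=
      (f.2.2.differentiableAt (isOpen_chartTarget.mem_nhds hy)).continuousAt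
    -- Moving along the diagonal makes both coordinates nonzero for all small `t ≠ 0`, so a point on
    -- an axis is a limit of points where `f` is known to vanish.
    have hp : ContinuousAt (fun t : ℂ => y + (t, t)) 0 := by fun_prop
    have hp0 : y + ((0 : ℂ), (0 : ℂ)) = y := by simp
    have hlim := (ContinuousAt.comp_of_eq hc hp hp0).tendsto.mono_left
      (nhdsWithin_le_nhds (s := {0}ᶜ))
    have hne : ∀ a : ℂ, ∀ᶠ t in 𝓝[≠] (0 : ℂ), a + t ≠ 0 := by
      intro a
      by_cases ha : a = 0
      · filter_upwards [self_mem_nhdsWithin] with t ht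
        simpa [ha] using ht
      · have : ContinuousAt (fun t : ℂ => a + t) 0 := by fun_prop
        exact nhdsWithin_le_nhds (this.eventually_ne (by simpa using ha))
    have hzero : ∀ᶠ t in 𝓝[≠] (0 : ℂ),
        ((extendZero fun y => f.1 (flipInv y)) ∘ fun t : ℂ => y + (t, t)) t = 0 := by
      filter_upwards [hne y.1, hne y.2] with t h1 h2
      by_cases ht : y + (t, t) ∈ chartTarget
      · simp only [Function.comp, extendZero, ht, dite_true]
        exact hflip ⟨_, ht⟩ h1 h2
      -- Outside the chart image the extension is zero by definition.
      · simp [Function.comp, extendZero, ht]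
    have := tendsto_nhds_unique (hlim.congr' hzero) tendsto_const_nhds
    rw [Function.comp_apply, hp0] at this
    simpa only [extendZero, hy, dite_true] using this
  apply Subtype.ext
  ext x
  rcases Omega.cases x with ⟨h1, h2⟩ | ⟨h1, h2⟩
  · obtain ⟨⟨x, y⟩, h⟩ := x
    obtain ⟨z, rfl⟩ := OnePoint.ne_infty_iff_exists.1 h1
    obtain ⟨w, rfl⟩ := OnePoint.ne_infty_iff_exists.1 h2
    exact hf ⟨(z, w), fun h' => h (congrArg OnePoint.some h')⟩
  · have hmem : (recip x.1.2, recip x.1.1) ∈ chartTarget := fun h =>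
      recip_sub_one_ne h1 h2 (sub_eq_zero.2 h)
    have : flipInv ⟨_, hmem⟩ = x := by
      apply Subtype.ext
      exact Prod.ext (sphereInv_recip h1) (sphereInv_recip h2)
    rw [← this]
    exact hflip' _

/-- All finite points lie in `Ω₊`, and they determine `f`. -/
lemma compPlusL_injective : Function.Injective compPlusL :=
  (injective_iff_map_eq_zero _).2 fun f hf => eq_zero_of_forall_stdInv fun y => by
    rw [← compPlusL_stdInv, hf]; rfl

lemma compMinusL_injective : Function.Injective compMinusL :=
  (injective_iff_map_eq_zero _).2 fun f hf => eq_zero_of_forall_stdInv fun y => by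
    rw [← compMinusL_stdInv, hf]; rfl

lemma extendsPlus_iff {F : HC2} {f : HOmega} : ExtendsPlus F f ↔ compPlusL f = F := by
  constructor
  · intro h
    apply Subtype.ext
    ext y
    exact (h (psiPlus.symm y)).trans (by rw [psiPlus.apply_symm_apply])
  · rintro rfl x
    exact congrArg (fun x : OmegaPlus => f.1 x.1) (psiPlus.symm_apply_apply x).symm

lemma extendsMinus_iff {F : HC2} {f : HOmega} : ExtendsMinus F f ↔ compMinusL f = F := by
  constructor
  · intro h
    apply Subtype.ext
    ext y
    exact (h (psiMinus.symm y)).trans (by rw [psiMinus.apply_symm_apply])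
  · rintro rfl x
    exact congrArg (fun x : OmegaMinus => f.1 x.1) (psiMinus.symm_apply_apply x).symm

/-! ### Growth along orbits of `(u, v) ↦ (l * u, v / l)` and Liouville's theorem -/

/-- Scaling multiplies `u ^ p * v ^ q` by `l ^ (p - q)`, of modulus at most 1 when `q ≤ p`; `M` is
the absolute sum of the series at `(u, v)`. -/
lemma norm_projPlusL_scale_le (F : HC2) (u v : ℂ) : ∃ M : ℝ, ∀ l : ℂ, l ≠ 0 → ‖l‖ ≤ 1 →
    ‖(projPlusL F).1 (l * u, l⁻¹ * v)‖ ≤ M := by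
  have hs := (entireCoeff_reindexCoeff {n | n.2 ≤ n.1} id (fun _ => le_rfl) F).summable_norm (u, v)
  refine ⟨_, fun l hl hl1 => tsum_of_norm_bounded hs.hasSum fun n => ?_⟩
  by_cases hn : n.2 ≤ n.1
  · rw [norm_mul, norm_mul]
    refine mul_le_mul_of_nonneg_left ?_ (norm_nonneg _)
    change ‖(l * u) ^ n.1 * (l⁻¹ * v) ^ n.2‖ ≤ ‖u ^ n.1 * v ^ n.2‖
    obtain ⟨k, hk⟩ := Nat.exists_eq_add_of_le hn
    have : (l * u) ^ n.1 * (l⁻¹ * v) ^ n.2 = l ^ k * (u ^ n.1 * v ^ n.2) := by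
      rw [hk, mul_pow, mul_pow, pow_add l, inv_pow]
      field_simp
    rw [this, norm_mul, norm_pow]
    exact mul_le_of_le_one_left (norm_nonneg _) (pow_le_one₀ (norm_nonneg _) hl1)
  · simp [reindexCoeff, hn]

/-- The strict inequality `p < q` provides at least one factor `l⁻¹`, hence decay and not only
boundedness. -/
lemma norm_projMinusL_scale_le (F : HC2) (u v : ℂ) : ∃ M : ℝ, ∀ l : ℂ, 1 ≤ ‖l‖ →
    ‖(projMinusL F).1 (l * u, l⁻¹ * v)‖ ≤ M * ‖l‖⁻¹ := by
  have hs := (entireCoeff_reindexCoeff {n | n.1 < n.2} id (fun _ => le_rfl) F).summable_norm (u, v)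
  refine ⟨_, fun l hl => tsum_of_norm_bounded (hs.hasSum.mul_right ‖l‖⁻¹) fun n => ?_⟩
  have hl0 : l ≠ 0 := norm_pos_iff.1 (by linarith)
  by_cases hn : n.1 < n.2
  · rw [norm_mul, norm_mul, mul_assoc]
    refine mul_le_mul_of_nonneg_left ?_ (norm_nonneg _)
    change ‖(l * u) ^ n.1 * (l⁻¹ * v) ^ n.2‖ ≤ ‖u ^ n.1 * v ^ n.2‖ * ‖l‖⁻¹
    obtain ⟨k, hk⟩ := Nat.exists_eq_add_of_lt hn
    have : (l * u) ^ n.1 * (l⁻¹ * v) ^ n.2 = u ^ n.1 * v ^ n.2 * l⁻¹ * l⁻¹ ^ k := by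
      rw [hk, mul_pow, mul_pow, pow_add l⁻¹, pow_add l⁻¹, inv_pow]
      field_simp
    rw [this, norm_mul, norm_mul _ l⁻¹, norm_pow, norm_inv]
    exact mul_le_of_le_one_right (by positivity)
      (pow_le_one₀ (by positivity) (inv_le_one_of_one_le₀ hl))
  · simp [reindexCoeff, hn]

/-- Boundedness makes the singularity at 0 removable; the resulting entire function tends to 0 at
infinity, so it vanishes by Liouville's theorem. -/
lemma eq_zero_of_bounded_of_decay {g : ℂ → ℂ} {M M' : ℝ} (hg : ∀ l ≠ 0, DifferentiableAt ℂ g l)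
    (h0 : ∀ l, l ≠ 0 → ‖l‖ ≤ 1 → ‖g l‖ ≤ M) (h1 : ∀ l, 1 ≤ ‖l‖ → ‖g l‖ ≤ M' * ‖l‖⁻¹)
    {l : ℂ} (hl : l ≠ 0) : g l = 0 := by
  let h := Function.update g 0 (Filter.limUnder (𝓝[≠] 0) g)
  have hball : DifferentiableOn ℂ h (ball 0 1) := by
    refine Complex.differentiableOn_update_limUnder_of_bddAbove (ball_mem_nhds _ one_pos)
      (fun z hz => (hg z hz.2).differentiableWithinAt) ⟨M, ?_⟩
    rintro _ ⟨z, hz, rfl⟩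
    exact h0 z hz.2 (mem_ball_zero_iff.1 hz.1).le
  have hne : ∀ z ≠ 0, h =ᶠ[𝓝 z] g := fun z hz => by
    filter_upwards [isOpen_ne.mem_nhds hz] with w hw
    exact Function.update_of_ne hw _ _
  have hd : Differentiable ℂ h := by
    intro z
    by_cases hz : z = 0
    · exact hz ▸ hball.differentiableAt (ball_mem_nhds _ one_pos)
    · exact (hg z hz).congr_of_eventuallyEq (hne z hz)
  have hlim : Filter.Tendsto h (Filter.cocompact ℂ) (𝓝 0) := by
    have ht := ((tendsto_norm_cocompact_atTop (E := ℂ)).inv_tendsto_atTop).const_mul M'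
    rw [mul_zero] at ht
    refine squeeze_zero_norm' ?_ ht
    filter_upwards [(tendsto_norm_cocompact_atTop (E := ℂ)).eventually_ge_atTop 1] with z hz
    have hz0 : z ≠ 0 := norm_pos_iff.1 (by linarith)
    rw [(hne z hz0).eq_of_nhds]
    exact h1 z hz
  rw [← (hne l hl).eq_of_nhds]
  exact hd.apply_eq_of_tendsto_cocompact l hlim

lemma eq_zero_of_proj_eq_zero {f : HOmega} (hp : projPlusL (compPlusL f) = 0)
    (hm : projMinusL (compMinusL f) = 0) : f = 0 := by
  have hG : projMinusL (compPlusL f) = compPlusL f := by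
    simpa [hp] using projPlusL_add_projMinusL (compPlusL f)
  have hH : projPlusL (compMinusL f) = compMinusL f := by
    simpa [hm] using projPlusL_add_projMinusL (compMinusL f)
  refine eq_zero_of_forall_stdInv ?_
  rintro ⟨⟨z, w⟩, hzw⟩
  have hmem : ∀ l : ℂ, l ≠ 0 → (l * z, l⁻¹ * w) ∈ chartTarget := by
    intro l hl h
    apply hzw
    change l * z * (l⁻¹ * w) = 1 at h
    rw [← h]
    field_simp
  obtain ⟨M, hM⟩ := norm_projPlusL_scale_le (compMinusL f) z (w / (1 - w * z))
  obtain ⟨M', hM'⟩ := norm_projMinusL_scale_le (compPlusL f) (z / (1 - z * w)) w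
  rw [hH] at hM
  rw [hG] at hM'
  -- Both sides are `f (l * z, w / l)`; the denominators do not change because the product of the
  -- coordinates is invariant.
  have hplus : ∀ l : ℂ, l ≠ 0 → (compPlusL f).1 (l * (z / (1 - z * w)), l⁻¹ * w) =
      (compMinusL f).1 (l * z, l⁻¹ * (w / (1 - w * z))) := by
    intro l hl
    have h1 := compPlusL_stdInv f ⟨_, hmem l hl⟩
    rw [← compMinusL_stdInv f ⟨_, hmem l hl⟩] at h1
    have e1 : l * z * (l⁻¹ * w) = z * w := by field_simp
    have e2 : l⁻¹ * w * (l * z) = w * z := by field_simp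
    simpa only [e1, e2, mul_div_assoc] using h1
  have key := eq_zero_of_bounded_of_decay
    (g := fun l => (compPlusL f).1 (l * (z / (1 - z * w)), l⁻¹ * w)) (fun l hl => ?_)
    (fun l hl hl1 => (hplus l hl).symm ▸ hM l hl hl1) hM' (one_ne_zero)
  · simpa only [one_mul, inv_one] using (compPlusL_stdInv f ⟨(z, w), hzw⟩).symm.trans
      (by simpa only [one_mul, inv_one] using key)
  · have hF : Differentiable ℂ (compPlusL f).1 := (compPlusL f).2
    have hi : DifferentiableAt ℂ (fun l : ℂ => (l * (z / (1 - z * w)), l⁻¹ * w)) l :=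
      (differentiableAt_id.mul_const _).prodMk ((differentiableAt_inv hl).mul_const w)
    exact (hF _).comp l hi

/-! ### The isomorphism -/

/-- The map `Φ`. -/
def glue : HC2 →L[ℂ] HOmega := extPlus.comp projPlusL + extMinus.comp projMinusL

/-- The inverse of the map `Φ`. -/
def unglue : HOmega →L[ℂ] HC2 := projPlusL.comp compPlusL + projMinusL.comp compMinusL

lemma unglue_glue (F : HC2) : unglue (glue F) = F := by
  have h1 := projPlusL_mem F
  have h2 := projMinusL_mem F
  change projPlusL (compPlusL (extPlus (projPlusL F) + extMinus (projMinusL F))) +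
    projMinusL (compMinusL (extPlus (projPlusL F) + extMinus (projMinusL F))) = F
  rw [map_add, map_add, map_add, map_add, compPlusL_extPlus h1, compMinusL_extMinus h2,
    projMinusL_compMinusL_extPlus h1, projPlusL_compPlusL_extMinus h2, projPlusL_of_mem_plus h1,
    projMinusL_of_mem_minus h2, add_zero, zero_add, projPlusL_add_projMinusL]

/-- Past and future meet only in 0, so each of the two projected terms vanishes separately. -/
lemma unglue_injective : Function.Injective unglue := by
  refine (injective_iff_map_eq_zero _).2 fun f hf => ?_
  have hsum : projPlusL (compPlusL f) + projMinusL (compMinusL f) = 0 := hf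
  refine eq_zero_of_proj_eq_zero ?_ ?_
  · have := congrArg projPlusL hsum
    rwa [map_add, projPlusL_of_mem_plus (projPlusL_mem _),
      projPlusL_of_mem_minus (projMinusL_mem _), add_zero, map_zero] at this
  · have := congrArg projMinusL hsum
    rwa [map_add, projMinusL_of_mem_plus (projPlusL_mem _),
      projMinusL_of_mem_minus (projMinusL_mem _), zero_add, map_zero] at this

/-- The map `Φ` as an isomorphism of topological vector spaces. -/
def glueEquiv : HC2 ≃L[ℂ] HOmega :=
  ContinuousLinearEquiv.equivOfInverse glue unglue unglue_glue
    -- `unglue (glue (unglue f)) = unglue f`, and injectivity cancels the outer `unglue`.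
    fun _ => unglue_injective (unglue_glue _)

lemma glue_monomial (p q : ℕ) : glue (monomial p q) = fpq p q := by
  change extPlus (projPlusL (monomial p q)) + extMinus (projMinusL (monomial p q)) = _
  rcases le_or_gt q p with h | h
  · rw [projPlusL_of_mem_plus (monomial_mem_HC2Plus h),
      projMinusL_of_mem_plus (monomial_mem_HC2Plus h), map_zero, add_zero, extPlus_monomial h]
  · rw [projPlusL_of_mem_minus (monomial_mem_HC2Minus h),
      projMinusL_of_mem_minus (monomial_mem_HC2Minus h), map_zero, zero_add, extMinus_monomial h.le]

/-- A linear homeomorphism commutes with spans and closures, so it suffices that `Φ` matches the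
generators. The relation `r` covers past and future at once. -/
lemma glueEquiv_image_closure_span (r : ℕ → ℕ → Prop) :
    glueEquiv '' (Submodule.span ℂ {F : HC2 | ∃ p q, r p q ∧ F = monomial p q}).topologicalClosure =
      (Submodule.span ℂ {f : HOmega | ∃ p q, r p q ∧ f = fpq p q}).topologicalClosure := by
  have h : glue '' {F : HC2 | ∃ p q, r p q ∧ F = monomial p q} =
      {f : HOmega | ∃ p q, r p q ∧ f = fpq p q} := by
    ext f
    constructor
    · rintro ⟨_, ⟨p, q, hr, rfl⟩, rfl⟩
      exact ⟨p, q, hr, glue_monomial p q⟩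
    · rintro ⟨p, q, hr, rfl⟩
      exact ⟨_, ⟨p, q, hr, rfl⟩, glue_monomial p q⟩
  rw [Submodule.topologicalClosure_coe, Submodule.topologicalClosure_coe, ← h,
    show glue '' _ = (glue : HC2 →ₗ[ℂ] HOmega) '' _ from rfl, Submodule.span_image]
  exact glueEquiv.toHomeomorph.image_closure _

end HolOmega

end

theorem theorem4p5 :
    -- the series that define `π₊ F` and `π₋ F` converge in `H(ℂ²)`
    (∀ F : HC2, Summable (fun n : {n : ℕ × ℕ // n.2 ≤ n.1} => taylorTerm F n) ∧
      Summable (fun n : {n : ℕ × ℕ // n.1 < n.2} => taylorTerm F n)) ∧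
    ∃ (Φp : HC2Plus →L[ℂ] HOmegaPlus) (Φm : HC2Minus →L[ℂ] HOmegaMinus)
      (Φ : HC2 ≃L[ℂ] HOmega),
      -- `Φ₊ F` and `Φ₋ F` are the holomorphic extensions of `F ∘ Ψ₊` and `F ∘ Ψ₋` to `Ω`
      (∀ (F : HC2Plus) (f : HOmega), ExtendsPlus F f ↔ f = Φp F) ∧
      (∀ (F : HC2Minus) (f : HOmega), ExtendsMinus F f ↔ f = Φm F) ∧
      (∀ F : HC2, Φ F = (Φp (projPlus F) : HOmega) + (Φm (projMinus F) : HOmega)) ∧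
      (∀ f : HOmega, Φ.symm f =
        (projPlus (compPsiPlusInv f) : HC2) + (projMinus (compPsiMinusInv f) : HC2)) ∧
      Φ '' (HC2Minus : Set HC2) = (HOmegaMinus : Set HOmega) ∧
      Φ '' (HC2Plus : Set HC2) = (HOmegaPlus : Set HOmega) := by
  refine ⟨fun F => ⟨(hasSum_subtype_taylorTerm {n | n.2 ≤ n.1} F).summable,
    (hasSum_subtype_taylorTerm {n | n.1 < n.2} F).summable⟩,
    (extPlus.comp HC2Plus.subtypeL).codRestrict HOmegaPlus fun F => extPlus_mem F.2,
    (extMinus.comp HC2Minus.subtypeL).codRestrict HOmegaMinus fun F => extMinus_mem F.2,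
    glueEquiv, fun F f => ?_, fun F f => ?_, fun F => ?_, fun f => ?_,
    glueEquiv_image_closure_span (· < ·), glueEquiv_image_closure_span fun p q => q ≤ p⟩
  · rw [extendsPlus_iff]
    -- Once `F` is written as the pullback of its own extension, existence and uniqueness together
    -- are injectivity of the pullback.
    nth_rw 1 [← compPlusL_extPlus F.2]
    exact compPlusL_injective.eq_iff
  · rw [extendsMinus_iff]
    nth_rw 1 [← compMinusL_extMinus F.2]
    exact compMinusL_injective.eq_iff
  · change glue F = extPlus (projPlus F) + extMinus (projMinus F)
    rw [coe_projPlus, coe_projMinus]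
    rfl
  · rw [coe_projPlus, coe_projMinus]
    rfl
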